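/- For integers $N\ge 0$, $r\ge 1$ let $S_{N,r}$ be the set of tuples $(n_1,\dots,n_r)$ of odd integers $n_i\ge 3$ with $n_1+\cdots+n_r=N$, let $\mathsf{Vect}_{N,r}$ be the space of rational row vectors indexed by $S_{N,r}$, let $\mathbf V_{N,r}\subset\mathbb Q[x_1,\dots,x_r]$ be the span of the monomials $x_1^{n_1-1}\cdots x_r^{n_r-1}$ with $(n_1,\dots,n_r)\in S_{N,r}$, and let $\pi\colon\mathbf V_{N,r}\to\mathsf{Vect}_{N,r}$ be the isomorphism taking a polynomial to its coefficient vector. For $r\ge2$ let $$\mathbf W_{N,r}=\{P\in\mathbf V_{N,r}: P(x_1,\dots,x_r)=P(x_2-x_1,x_2,x_3,\dots,x_r)-P(x_2-x_1,x_1,x_3,\dots,x_r)\}.$$ For a homogeneous $f\in\mathbb Q[x_1]$ and $g\in\mathbb Q[x_1,\dots,x_{r-1}]$ put $$(f\circ g)(x_1,\dots,x_r)=f(x_1)g(x_2,\dots,x_r)+\sum_{i=1}^{r-1}\Bigl(f(x_{i+1}-x_i)\,g(x_1,\dots,\hat x_{i+1},\dots,x_r)-(-1)^{\deg f}f(x_i-x_{i+1})\,g(x_1,\dots,\hat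 x_i,\dots,x_r)\Bigr),$$ where a hat means that the variable is omitted, and let $e(m_1,\dots,m_r;n_1,\dots,n_r)$ be the coefficient of $x_1^{n_1-1}\cdots x_r^{n_r-1}$ in $x_1^{m_1-1}\circ(x_1^{m_2-1}\cdots x_{r-1}^{m_r-1})$. Define matrices with rows and columns indexed by $m,n\in S_{N,r}$: $E_{N,r}$ has entries $e(m;n)$; for $2\le j\le r$, $E^{(j)}_{N,r}$ has entries $\delta_{(m_1,\dots,m_{r-j}),(n_1,\dots,n_{r-j})}\,e(m_{r-j+1},\dots,m_r;n_{r-j+1},\dots,n_r)$; and $$C_{N,r}=E_{N,r}^{(2)}E_{N,r}^{(3)}\cdots E_{N,r}^{(r-1)}E_{N,r}$$ (so $C_{N,1}=E_{N,1}$ and $C_{N,2}=E_{N,2}$). For $2\le j\le r$ let $\phi_j\colon\mathbf V_{N,r}\to\mathbf V_{N,r}$ take $Q$ to the sum of those monomials, with all exponents even and at least $2$, of the polynomial $$Q+\sum_{i=r-j+1}^{r-1}\Bigl(Q(x_1,\dots,x_{r-j},x_{i+1}-x_i,x_{r-j+1},\dots,\hat x_{i+1},\dots,x_r)-Q(x_1,\dots,x_{r-j},x_{i+1}-x_i,x_{r-j+1},\dots,\hat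 x_i,\dots,x_r)\Bigr).$$ Assume the following two conjectural statements. 1. (Injectivity of Tasaka's map.) For all $r\ge2$ and $N>0$ the linear map $\mathbf W_{N,r}\to\ker{}^tE_{N,r}$, $P\mapsto\pi(P)(E_{N,r}-\mathrm{id})$, is injective. 2. For all $r\ge3$ and $N>0$, $$(\phi_{r-1}\circ\cdots\circ\phi_2)(\mathbf W_{N,r})=\ker\phi_r\cap\operatorname{Im}(\phi_{r-1}\circ\cdots\circ\phi_2).$$ Then, in $\mathbb Q[[x]][[y]]$, $$1+\sum_{N,r>0}\operatorname{rank}C_{N,r}\,x^Ny^r=\frac{1}{1-\mathbb O(x)y+\mathbb S(x)y^2},\qquad \mathbb O(x)=\frac{x^3}{1-x^2},\quad \mathbb S(x)=\frac{x^{12}}{(1-x^4)(1-x^6)}.$$ -/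

import Mathlib

open scoped Polynomial

/-- The set `S_{N,r}` of totally odd indices: tuples `(n_1, …, n_r)` of odd integers `≥ 3`
with sum `N`. The entry `n_k` is the value at the element `k - 1` of `Fin r`. -/
def oddIndices (N r : ℕ) : Finset (Fin r → ℕ) :=
  (Finset.Nat.antidiagonalTuple r N).filter fun n => ∀ i, 3 ≤ n i ∧ Odd (n i)

/-- `S_{N,r}` as a type, used to index vectors and matrices. -/
abbrev OddIdx (N r : ℕ) : Type := {n : Fin r → ℕ // n ∈ oddIndices N r}

/-- The space `Vect_{N,r}` of row vectors indexed by `S_{N,r}`. -/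
abbrev OddVect (N r : ℕ) : Type := OddIdx N r → ℚ

/-- The `k`-th entry `m_k` (numbered from `1`) of an `r`-tuple; it is used for `1 ≤ k ≤ r`. -/
def tupleEntry {r : ℕ} (m : Fin r → ℕ) (k : ℕ) : ℕ :=
  if h : k - 1 < r then m ⟨k - 1, h⟩ else 0

/-- The exponent vector of the monomial `x_1^{n_1 - 1} ⋯ x_r^{n_r - 1}`. -/
noncomputable def shiftedExponent {r : ℕ} (n : Fin r → ℕ) : Fin r →₀ ℕ :=
  Finsupp.equivFunOnFinite.symm fun i => n i - 1

/-- The variable `x_k` (numbered from `1`) of `ℚ[x_1, …, x_r]`; it is used for `1 ≤ k ≤ r`. -/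
noncomputable def polyVar (r k : ℕ) : MvPolynomial (Fin r) ℚ :=
  if h : k - 1 < r then MvPolynomial.X ⟨k - 1, h⟩ else 0

/-- The `k`-th entry (numbered from `1`) of the sequence `x_1, …, x_r` with `x_p` omitted. -/
noncomputable def omitVar (r p k : ℕ) : MvPolynomial (Fin r) ℚ :=
  if k < p then polyVar r k else polyVar r (k + 1)

/-- The Ihara action `f ∘ g ∈ ℚ[x_1, …, x_r]` of `f` (one variable, homogeneous) on
`g` (`r - 1` variables):
`f(x_1) g(x_2, …, x_r) + ∑_{i=1}^{r-1} ( f(x_{i+1} - x_i) g(x_1, …, x̂_{i+1}, …, x_r)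
  - (-1)^{deg f} f(x_i - x_{i+1}) g(x_1, …, x̂_i, …, x_r) )`. -/
noncomputable def iharaAction (r : ℕ) (f : ℚ[X]) (g : MvPolynomial (Fin (r - 1)) ℚ) :
    MvPolynomial (Fin r) ℚ :=
  Polynomial.aeval (polyVar r 1) f *
      MvPolynomial.aeval (fun k : Fin (r - 1) => polyVar r (k.val + 2)) g +
    ∑ i ∈ Finset.Ico 1 r,
      (Polynomial.aeval (polyVar r (i + 1) - polyVar r i) f *
          MvPolynomial.aeval (fun k : Fin (r - 1) => omitVar r (i + 1) (k.val + 1)) g -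
        (-1) ^ f.natDegree * Polynomial.aeval (polyVar r i - polyVar r (i + 1)) f *
          MvPolynomial.aeval (fun k : Fin (r - 1) => omitVar r i (k.val + 1)) g)

/-- The integer `e(m_1, …, m_r; n_1, …, n_r)` (as a rational number): the coefficient of
`x_1^{n_1-1} ⋯ x_r^{n_r-1}` in `x_1^{m_1-1} ∘ (x_1^{m_2-1} ⋯ x_{r-1}^{m_r-1})`.
The tuples are given as sequences of which only the entries `1, …, r` matter. -/
noncomputable def iharaCoeff (r : ℕ) (m n : ℕ → ℕ) : ℚ :=
  MvPolynomial.coeff (shiftedExponent fun i : Fin r => n (i.val + 1))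
    (iharaAction r (Polynomial.X ^ (m 1 - 1))
      (∏ k : Fin (r - 1), MvPolynomial.X k ^ (m (k.val + 2) - 1)))

/-- The matrix `E_{N,r}` (for `r ≥ 1`). -/
noncomputable def matE (N r : ℕ) : Matrix (OddIdx N r) (OddIdx N r) ℚ :=
  Matrix.of fun m n => iharaCoeff r (tupleEntry m.1) (tupleEntry n.1)

/-- The matrix `E_{N,r}^{(j)}` (for `2 ≤ j ≤ r`), with entries
`δ(m_1, …, m_{r-j}; n_1, …, n_{r-j}) e(m_{r-j+1}, …, m_r; n_{r-j+1}, …, n_r)`. -/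
noncomputable def matEj (N r j : ℕ) : Matrix (OddIdx N r) (OddIdx N r) ℚ :=
  Matrix.of fun m n =>
    if ∀ i : Fin r, i.val < r - j → m.1 i = n.1 i then
      iharaCoeff j (fun k => tupleEntry m.1 (r - j + k)) (fun k => tupleEntry n.1 (r - j + k))
    else 0

/-- The matrix `C_{N,r} = E_{N,r}^{(2)} E_{N,r}^{(3)} ⋯ E_{N,r}^{(r-1)} E_{N,r}` (for `r ≥ 1`). -/
noncomputable def matC (N r : ℕ) : Matrix (OddIdx N r) (OddIdx N r) ℚ :=
  ((List.range' 2 (r - 2)).map (matEj N r)).prod * matE N r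

/-- The space `V_{N,r}` of restricted totally even homogeneous polynomials of degree `N - r`. -/
noncomputable def evenPolys (N r : ℕ) : Submodule ℚ (MvPolynomial (Fin r) ℚ) :=
  Submodule.span ℚ
    (Set.range fun m : OddIdx N r => MvPolynomial.monomial (shiftedExponent m.1) (1 : ℚ))

/-- The isomorphism `π : V_{N,r} → Vect_{N,r}` taking a polynomial to its coefficient vector. -/
noncomputable def coeffVector (N r : ℕ) : evenPolys N r →ₗ[ℚ] OddVect N r where
  toFun P := fun n => MvPolynomial.coeff (shiftedExponent n.1) P.1
  map_add' P Q := by ext n; simp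
  map_smul' c P := by ext n; simp

/-- The subspace `W_{N,r}` (for `r ≥ 2`) of those `P ∈ V_{N,r}` with
`P(x_1, …, x_r) = P(x_2 - x_1, x_2, x_3, …, x_r) - P(x_2 - x_1, x_1, x_3, …, x_r)`. -/
noncomputable def periodPolys (N r : ℕ) : Submodule ℚ (evenPolys N r) where
  carrier := {P | P.1 =
    MvPolynomial.aeval (fun k : Fin r =>
      if k.val = 0 then polyVar r 2 - polyVar r 1
      else if k.val = 1 then polyVar r 2 else polyVar r (k.val + 1)) P.1 -
    MvPolynomial.aeval (fun k : Fin r =>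
      if k.val = 0 then polyVar r 2 - polyVar r 1
      else if k.val = 1 then polyVar r 1 else polyVar r (k.val + 1)) P.1}
  add_mem' {P Q} hP hQ := by
    simp only [Set.mem_ofPred_eq, Submodule.coe_add, map_add] at *
    nth_rewrite 1 [hP, hQ]
    abel
  zero_mem' := by simp
  smul_mem' c P hP := by
    simp only [Set.mem_ofPred_eq, Submodule.coe_smul, map_smul] at *
    nth_rewrite 1 [hP]
    rw [smul_sub]

/-- The map `W_{N,r} → Vect_{N,r}`, `P ↦ π(P) F_{N,r}` with `F_{N,r} = E_{N,r} - id`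
(its image lies in the left kernel of `E_{N,r}`; whether it is injective does not depend on the
codomain). -/
noncomputable def tasakaMap (N r : ℕ) : periodPolys N r →ₗ[ℚ] OddVect N r :=
  (matE N r - 1).vecMulLinear ∘ₗ coeffVector N r ∘ₗ (periodPolys N r).subtype

/-- The restricted totally even part of a polynomial: the sum of those of its monomials in which
every exponent is even and at least `2`. -/
noncomputable def totallyEvenPart (r : ℕ) :
    MvPolynomial (Fin r) ℚ →ₗ[ℚ] MvPolynomial (Fin r) ℚ where
  toFun Q := ∑ d ∈ Q.support with ∀ i, Even (d i) ∧ 2 ≤ d i,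
    MvPolynomial.monomial d (MvPolynomial.coeff d Q)
  map_add' P Q := by
    classical
    ext d
    simp only [MvPolynomial.coeff_add, MvPolynomial.coeff_sum, MvPolynomial.coeff_monomial,
      Finset.sum_ite_eq', Finset.mem_filter, MvPolynomial.mem_support_iff]
    by_cases h : ∀ i, Even (d i) ∧ 2 ≤ d i <;> simp [h]
    split_ifs <;> simp_all
  map_smul' c P := by
    classical
    ext d
    simp only [MvPolynomial.coeff_smul, MvPolynomial.coeff_sum, MvPolynomial.coeff_monomial,
      Finset.sum_ite_eq', Finset.mem_filter, MvPolynomial.mem_support_iff, RingHom.id_apply]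
    by_cases h : ∀ i, Even (d i) ∧ 2 ≤ d i <;> simp [h]
    split_ifs <;> simp_all

/-- The `k`-th entry (numbered from `1`) of the sequence
`x_1, …, x_{r-j}, x_{i+1} - x_i, x_{r-j+1}, …, x̂_p, …, x_r`, where `r - j < p`. -/
noncomputable def phiArg (r j i p k : ℕ) : MvPolynomial (Fin r) ℚ :=
  if k ≤ r - j then polyVar r k
  else if k = r - j + 1 then polyVar r (i + 1) - polyVar r i
  else omitVar r p (k - 1)

/-- The polynomial `Q + ∑_{i=r-j+1}^{r-1} (
  Q(x_1, …, x_{r-j}, x_{i+1} - x_i, x_{r-j+1}, …, x̂_{i+1}, …, x_r)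
  - Q(x_1, …, x_{r-j}, x_{i+1} - x_i, x_{r-j+1}, …, x̂_i, …, x_r))`. -/
noncomputable def phiPoly (r j : ℕ) : MvPolynomial (Fin r) ℚ →ₗ[ℚ] MvPolynomial (Fin r) ℚ :=
  LinearMap.id + ∑ i ∈ Finset.Ico (r - j + 1) r,
    ((MvPolynomial.aeval fun k : Fin r => phiArg r j i (i + 1) (k.val + 1)).toLinearMap -
      (MvPolynomial.aeval fun k : Fin r => phiArg r j i i (k.val + 1)).toLinearMap)

lemma polyVar_isHomogeneous (r k : ℕ) : (polyVar r k).IsHomogeneous 1 := by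
  unfold polyVar
  split_ifs
  · exact MvPolynomial.isHomogeneous_X _ _
  · exact MvPolynomial.isHomogeneous_zero _ _ _

lemma phiArg_isHomogeneous (r j i p k : ℕ) : (phiArg r j i p k).IsHomogeneous 1 := by
  unfold phiArg omitVar
  split_ifs
  · exact polyVar_isHomogeneous _ _
  · exact (polyVar_isHomogeneous _ _).sub (polyVar_isHomogeneous _ _)
  · exact polyVar_isHomogeneous _ _
  · exact polyVar_isHomogeneous _ _

lemma phiPoly_isHomogeneous (r j D : ℕ) {Q : MvPolynomial (Fin r) ℚ} (hQ : Q.IsHomogeneous D) :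
    (phiPoly r j Q).IsHomogeneous D := by
  have key : ∀ i p, (MvPolynomial.aeval (fun k : Fin r => phiArg r j i p (k.val + 1))
      Q).IsHomogeneous D := fun i p => by
    simpa using hQ.aeval (n := 1) _ fun k => phiArg_isHomogeneous r j i p (k.val + 1)
  simp only [phiPoly, LinearMap.add_apply, LinearMap.id_apply, LinearMap.sum_apply,
    LinearMap.sub_apply, AlgHom.toLinearMap_apply]
  exact hQ.add (MvPolynomial.IsHomogeneous.sum _ _ _ fun i _ => (key i _).sub (key i _))

lemma totallyEvenPart_mem (N r D : ℕ) (hD : D + r = N) {Q : MvPolynomial (Fin r) ℚ}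
    (hQ : Q.IsHomogeneous D) : totallyEvenPart r Q ∈ evenPolys N r := by
  refine Submodule.sum_mem _ fun d hd => ?_
  rw [Finset.mem_filter, MvPolynomial.mem_support_iff] at hd
  have hdeg : ∑ i, d i = D := by
    have := hQ hd.1
    rwa [show Finsupp.weight (1 : Fin r → ℕ) d = d.degree by
      rw [Finsupp.degree_eq_weight_one]; rfl, Finsupp.degree_eq_sum] at this
  have hm : (fun i => d i + 1) ∈ oddIndices N r := by
    simp only [oddIndices, Finset.mem_filter, Finset.Nat.mem_antidiagonalTuple]
    refine ⟨by simp [Finset.sum_add_distrib, hdeg, hD], fun i => ?_⟩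
    exact ⟨by have := (hd.2 i).2; omega, (hd.2 i).1.add_one⟩
  have he : shiftedExponent (fun i => d i + 1) = d := by
    ext i
    simp [shiftedExponent]
  have hc : MvPolynomial.monomial d (MvPolynomial.coeff d Q) =
      MvPolynomial.coeff d Q • MvPolynomial.monomial d (1 : ℚ) := by
    rw [MvPolynomial.smul_monomial, smul_eq_mul, mul_one]
  rw [hc]
  refine Submodule.smul_mem _ _ (Submodule.subset_span ⟨⟨_, hm⟩, ?_⟩)
  simp only [he]

lemma phi_mem (N r j : ℕ) {Q : MvPolynomial (Fin r) ℚ} (hQ : Q ∈ evenPolys N r) :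
    (totallyEvenPart r ∘ₗ phiPoly r j) Q ∈ evenPolys N r := by
  refine (Submodule.span_le (p := (evenPolys N r).comap (totallyEvenPart r ∘ₗ phiPoly r j))).2
    ?_ hQ
  rintro _ ⟨m, rfl⟩
  have hm := m.2
  simp only [oddIndices, Finset.mem_filter, Finset.Nat.mem_antidiagonalTuple] at hm
  refine totallyEvenPart_mem N r (∑ i, (m.1 i - 1)) ?_ (phiPoly_isHomogeneous r j _ ?_)
  · refine Eq.trans ?_ hm.1
    have : ∀ i, m.1 i = (m.1 i - 1) + 1 := fun i => by have := (hm.2 i).1; omega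
    conv_rhs => rw [Finset.sum_congr rfl fun i _ => this i]
    simp [Finset.sum_add_distrib]
  · apply MvPolynomial.isHomogeneous_monomial
    rw [Finsupp.degree_eq_sum]
    simp [shiftedExponent]

/-- The endomorphism `φ_j` of `V_{N,r}` (for `1 ≤ j ≤ r`). -/
noncomputable def phi (N r j : ℕ) : evenPolys N r →ₗ[ℚ] evenPolys N r :=
  (totallyEvenPart r ∘ₗ phiPoly r j).restrict fun _ hQ => phi_mem N r j hQ

/-- The composition `φ_j ∘ φ_{j-1} ∘ ⋯ ∘ φ_2` on `V_{N,r}` (the identity if `j < 2`). -/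
noncomputable def phiComp (N r : ℕ) : ℕ → (evenPolys N r →ₗ[ℚ] evenPolys N r)
  | 0 => LinearMap.id
  | 1 => LinearMap.id
  | j + 2 => phi N r (j + 2) ∘ₗ phiComp N r (j + 1)

/-- For all `r ≥ 2` and all `N > 0`, the map `W_{N,r} → ker ᵗE_{N,r}`, `P ↦ π(P) F_{N,r}`,
is injective. -/
def TasakaInjectivity : Prop :=
  ∀ r N : ℕ, 2 ≤ r → 0 < N → Function.Injective (tasakaMap N r)

/-- For all `r ≥ 3` and all `N > 0`, the image of `W_{N,r}` under `φ_{r-1} ∘ ⋯ ∘ φ_2` equals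
`ker φ_r ∩ Im (φ_{r-1} ∘ ⋯ ∘ φ_2)`. -/
def ImageKernelConjecture : Prop :=
  ∀ r N : ℕ, 3 ≤ r → 0 < N →
    (periodPolys N r).map (phiComp N r (r - 1)) =
      LinearMap.ker (phi N r r) ⊓ LinearMap.range (phiComp N r (r - 1))

/-- `𝕆(x) = x^3 / (1 - x^2)`. -/
noncomputable def seriesO : PowerSeries ℚ :=
  PowerSeries.X ^ 3 * (1 - PowerSeries.X ^ 2)⁻¹

/-- `𝕊(x) = x^12 / ((1 - x^4) (1 - x^6))`. -/
noncomputable def seriesS : PowerSeries ℚ :=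
  PowerSeries.X ^ 12 * ((1 - PowerSeries.X ^ 4) * (1 - PowerSeries.X ^ 6))⁻¹

/-- `1 + ∑_{N,r>0} rank C_{N,r} x^N y^r` in `ℚ⟦x⟧⟦y⟧`. -/
noncomputable def rankSeries : PowerSeries (PowerSeries ℚ) :=
  1 + PowerSeries.mk fun r => PowerSeries.mk fun N =>
    if 0 < N ∧ 0 < r then ((matC N r).rank : ℚ) else 0

/-! Write Φ_j = φ_j ∘ ⋯ ∘ φ_2. Under the coefficient map π, right multiplication by C_{N,r} becomes
Φ_r (`coeffEquiv_phiComp`), so rank C_{N,r} = dim Im Φ_r. With o_n and s_n the coefficients of 𝕆 and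
𝕊, the identity amounts to rank C_{N,r} = ∑ o_n rank C_{N-n,r-1} - ∑ s_n rank C_{N-n,r-2} for r ≥ 2
(`rankCoeff_add`), and this is rank-nullity for φ_r on Im Φ_{r-1}.

The map φ_j changes only the last j variables. Hence on V_{N,r} the map Φ_{r-1} is a direct sum of
its depth r-1 versions, one for each exponent of x_1; this gives the first sum. For r ≥ 3 the kernel
is Φ_{r-1}(W_{N,r}) by the second assumption. The relation defining W involves only x_1 and x_2, so
W_{N,r} is the sum of the W_{n,2} ⊗ V_{N-n,r-2}, and Φ_{r-2} acts on the second factors. So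
Φ_{r-2}(W_{N,r}) lies in W_{N,r} and has dimension ∑ dim W_{n,2} rank C_{N-n,r-2}. The remaining map
φ_{r-1} is injective on W_{N,r}, because Tasaka's map is -π ∘ φ_{r-1} there (`tasakaMap_eq`).

Two facts in depth two need no assumption: ker φ_2 = W_{N,2} (`ker_phi_two`) and ∑ dim W_{N,2} x^N =
𝕊 (`seriesS_eq`). Both use the action of S_3 on binary forms of even degree generated by the swap
and by U : p(x, y) ↦ p(x - y, x). On antisymmetric even polynomials W_{N,2} is the kernel of 1 + U +
U², which maps onto the antisymmetric invariants (`exists_rotSum_eq`); these are counted by division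
by x²y²(x - y)² (`bijective_invPolysStep`). -/

/-! ### Linear algebra: images of maps acting slice by slice. -/

lemma finrank_range_piMap {ι : Type*} [Fintype ι] {φ ψ : ι → Type*}
    [∀ i, AddCommGroup (φ i)] [∀ i, Module ℚ (φ i)] [∀ i, AddCommGroup (ψ i)]
    [∀ i, Module ℚ (ψ i)] [∀ i, FiniteDimensional ℚ (φ i)] (f : ∀ i, φ i →ₗ[ℚ] ψ i) :
    Module.finrank ℚ (LinearMap.range (LinearMap.piMap f)) =
      ∑ i, Module.finrank ℚ (LinearMap.range (f i)) := by
  have hinj : Function.Injective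
      (LinearMap.piMap fun i => (LinearMap.range (f i)).subtype) := by
    intro u v h
    funext i
    exact Subtype.ext (congrFun h i)
  have hrange : LinearMap.range (LinearMap.piMap f) =
      LinearMap.range (LinearMap.piMap fun i => (LinearMap.range (f i)).subtype) := by
    ext v
    constructor
    · rintro ⟨u, rfl⟩
      exact ⟨fun i => ⟨f i (u i), u i, rfl⟩, rfl⟩
    · rintro ⟨u, rfl⟩
      choose w hw using fun i => (u i).2
      exact ⟨w, funext hw⟩
  rw [hrange, LinearMap.finrank_range_of_inj hinj, Module.finrank_pi_fintype]

lemma Matrix.finrank_range_vecMulLinear {J : Type*} [Fintype J] (M : Matrix J J ℚ) :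
    Module.finrank ℚ (LinearMap.range M.vecMulLinear) = M.rank := by
  rw [← Matrix.rank_transpose, Matrix.rank, Matrix.mulVecLin_transpose]

/-- An endomorphism acting on the second index by matrices maps the space of those vectors, whose
slices in the first index lie in given subspaces `W n`, into itself, and the image has dimension
`∑ n, dim (W n) * rank (M n)`. -/
lemma finrank_map_of_slices {ι : Type*} [Fintype ι] {I J : ι → Type*} [∀ n, Fintype (I n)]
    [∀ n, Fintype (J n)] (W : ∀ n, Submodule ℚ (I n → ℚ)) (M : ∀ n, Matrix (J n) (J n) ℚ)
    {V : Type*} [AddCommGroup V] [Module ℚ V] (e : V ≃ₗ[ℚ] (∀ n, I n → J n → ℚ))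
    (W' : Submodule ℚ V) (hW' : ∀ v, v ∈ W' ↔ ∀ n t, (fun a => e v n a t) ∈ W n)
    (L : V →ₗ[ℚ] V) (hL : ∀ v n a, e (L v) n a = Matrix.vecMul (e v n a) (M n)) :
    Module.finrank ℚ (W'.map L) = ∑ n, Module.finrank ℚ (W n) * (M n).rank := by
  set b : ∀ n, Module.Basis (Fin (Module.finrank ℚ (W n))) ℚ (W n) := fun n =>
    Module.finBasis ℚ (W n) with hb
  -- Expanding slices in the bases `b n` identifies `W'` with `dim (W n)` copies of `J n → ℚ` for
  -- each `n`; on each copy `L` becomes multiplication by `M n`, which is `F` below.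
  let G : (∀ n, Fin (Module.finrank ℚ (W n)) → J n → ℚ) →ₗ[ℚ] (∀ n, I n → J n → ℚ) :=
    { toFun := fun g n a t => ∑ i, g n i t * (b n i).1 a
      map_add' := by
        intro g h
        funext n a t
        simp [add_mul, Finset.sum_add_distrib]
      map_smul' := by
        intro c g
        funext n a t
        simp [Finset.mul_sum, mul_assoc] }
  have hG : ∀ g n t, (fun a => G g n a t) = (∑ i, g n i t • b n i : W n).1 := by
    intro g n t
    funext a
    simp [G]
  have hGinj : Function.Injective G := by
    intro g h hgh
    funext n i t
    have h1 : (∑ i, g n i t • b n i : W n) = ∑ i, h n i t • b n i := by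
      apply Subtype.ext
      rw [← hG, ← hG, hgh]
    have h2 := congrArg (fun w => (b n).repr w i) h1
    simpa [map_sum, Finsupp.single_apply] using h2
  let F : (∀ n, Fin (Module.finrank ℚ (W n)) → J n → ℚ) →ₗ[ℚ]
      (∀ n, Fin (Module.finrank ℚ (W n)) → J n → ℚ) :=
    LinearMap.piMap fun n => LinearMap.piMap fun _ => (M n).vecMulLinear
  have hGF : ∀ g n a, G (F g) n a = Matrix.vecMul (G g n a) (M n) := by
    intro g n a
    funext t
    simp only [G, F, LinearMap.coe_mk, AddHom.coe_mk, LinearMap.coe_piMap, Pi.map_apply,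
      Matrix.vecMulLinear_apply, Matrix.vecMul, dotProduct, Finset.sum_mul]
    rw [Finset.sum_comm]
    exact Finset.sum_congr rfl fun _ _ => Finset.sum_congr rfl fun _ _ => by ring
  have hmap : (W'.map L).map e.toLinearMap = (LinearMap.range F).map G := by
    ext u
    constructor
    · rintro ⟨_, ⟨v, hv, rfl⟩, rfl⟩
      refine ⟨_, ⟨fun n i t => (b n).repr ⟨_, (hW' v).1 hv n t⟩ i, rfl⟩, ?_⟩
      have h0 : G (fun n i t => (b n).repr ⟨_, (hW' v).1 hv n t⟩ i) = e v := by
        funext n a t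
        have := congrFun (hG (fun n i t => (b n).repr ⟨_, (hW' v).1 hv n t⟩ i) n t) a
        rw [(b n).sum_repr] at this
        exact this
      funext n a
      rw [hGF, h0]
      exact (hL v n a).symm
    · rintro ⟨_, ⟨g, rfl⟩, rfl⟩
      refine ⟨_, ⟨e.symm (G g), (hW' _).2 fun n t => ?_, rfl⟩, ?_⟩
      · rw [e.apply_symm_apply, hG]
        exact (∑ i, g n i t • b n i : W n).2
      · funext n a
        rw [hGF]
        exact (hL _ n a).trans (by rw [e.apply_symm_apply])
  have h1 : Module.finrank ℚ ((W'.map L).map e.toLinearMap) = Module.finrank ℚ (W'.map L) :=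
    LinearEquiv.finrank_map_eq e _
  rw [← h1, hmap, (Submodule.equivMapOfInjective G hGinj _).symm.finrank_eq]
  simp only [F]
  rw [finrank_range_piMap]
  refine Finset.sum_congr rfl fun n _ => ?_
  rw [finrank_range_piMap]
  simp [Matrix.finrank_range_vecMulLinear]

/-- Under the hypotheses of `finrank_map_of_slices`, the endomorphism preserves the subspace. -/
lemma map_le_of_slices {ι : Type*} {I J : ι → Type*}
    [∀ n, Fintype (J n)] (W : ∀ n, Submodule ℚ (I n → ℚ)) (M : ∀ n, Matrix (J n) (J n) ℚ)
    {V : Type*} [AddCommGroup V] [Module ℚ V] (e : V ≃ₗ[ℚ] (∀ n, I n → J n → ℚ))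
    (W' : Submodule ℚ V) (hW' : ∀ v, v ∈ W' ↔ ∀ n t, (fun a => e v n a t) ∈ W n)
    (L : V →ₗ[ℚ] V) (hL : ∀ v n a, e (L v) n a = Matrix.vecMul (e v n a) (M n)) :
    W'.map L ≤ W' := by
  rintro _ ⟨v, hv, rfl⟩
  refine (hW' _).2 fun n t => ?_
  have : (fun a => e (L v) n a t) = ∑ s, M n s t • fun a => e v n a s := by
    funext a
    rw [hL]
    simp [Matrix.vecMul, dotProduct, mul_comm]
  rw [this]
  exact Submodule.sum_mem _ fun s _ => Submodule.smul_mem _ _ ((hW' v).1 hv n s)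

/-- Rank-nullity for the restriction of `f` to the range of `g`. -/
lemma finrank_range_comp_add_finrank_inf {V : Type*} [AddCommGroup V] [Module ℚ V]
    [FiniteDimensional ℚ V] (f g : V →ₗ[ℚ] V) :
    Module.finrank ℚ (LinearMap.range (f ∘ₗ g)) +
      Module.finrank ℚ (LinearMap.ker f ⊓ LinearMap.range g : Submodule ℚ V) =
      Module.finrank ℚ (LinearMap.range g) := by
  have h := LinearMap.finrank_range_add_finrank_ker (f.domRestrict (LinearMap.range g))
  rw [LinearMap.range_domRestrict, LinearMap.ker_domRestrict, ← LinearMap.range_comp] at h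
  rw [← h, inf_comm]
  congr 1
  rw [← Submodule.map_comap_subtype]
  exact (Submodule.equivMapOfInjective _ (Submodule.subtype_injective _) _).symm.finrank_eq

/-! ### Coefficients and the monomial basis of V_{N,r}. -/

open MvPolynomial in
/-- Coefficients of a product of a polynomial in the first `k` variables and a polynomial in the
last `l` variables. -/
lemma coeff_rename_castAdd_mul_rename_natAdd {k l : ℕ} (p : MvPolynomial (Fin k) ℚ)
    (q : MvPolynomial (Fin l) ℚ) (d : Fin (k + l) →₀ ℕ) :
    coeff d (rename (Fin.castAdd l) p * rename (Fin.natAdd k) q) =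
      coeff (Finsupp.equivFunOnFinite.symm fun i => d (Fin.castAdd l i)) p *
        coeff (Finsupp.equivFunOnFinite.symm fun i => d (Fin.natAdd k i)) q := by
  classical
  induction p using MvPolynomial.induction_on' with
  | add p₁ p₂ h₁ h₂ => simp only [map_add, add_mul, coeff_add, h₁, h₂]
  | monomial a c =>
    induction q using MvPolynomial.induction_on' with
    | add q₁ q₂ h₁ h₂ => simp only [map_add, mul_add, coeff_add, h₁, h₂]
    | monomial b c' =>
      rw [rename_monomial, rename_monomial, monomial_mul, coeff_monomial, coeff_monomial,
        coeff_monomial]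
      have hca : Function.Injective (Fin.castAdd l : Fin k → _) := Fin.castAdd_injective k l
      have hna : Function.Injective (Fin.natAdd k : Fin l → _) := Fin.natAdd_injective l k
      have e1 : ∀ i, (Finsupp.mapDomain (Fin.castAdd l) a + Finsupp.mapDomain (Fin.natAdd k) b)
          (Fin.castAdd l i) = a i := by
        intro i
        rw [Finsupp.add_apply, Finsupp.mapDomain_apply hca, Finsupp.mapDomain_of_notMem_range, add_zero]
        rintro ⟨j, hj⟩
        have := congrArg Fin.val hj
        simp at this
        omega
      have e2 : ∀ i, (Finsupp.mapDomain (Fin.castAdd l) a + Finsupp.mapDomain (Fin.natAdd k) b)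
          (Fin.natAdd k i) = b i := by
        intro i
        rw [Finsupp.add_apply, Finsupp.mapDomain_apply hna, Finsupp.mapDomain_of_notMem_range, zero_add]
        rintro ⟨j, hj⟩
        have := congrArg Fin.val hj
        simp at this
        omega
      have key : Finsupp.mapDomain (Fin.castAdd l) a + Finsupp.mapDomain (Fin.natAdd k) b = d ↔
          a = (Finsupp.equivFunOnFinite.symm fun i => d (Fin.castAdd l i)) ∧
          b = (Finsupp.equivFunOnFinite.symm fun i => d (Fin.natAdd k i)) := by
        constructor
        · rintro rfl
          exact ⟨by ext i; simpa using (e1 i).symm, by ext i; simpa using (e2 i).symm⟩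
        · rintro ⟨h1, h2⟩
          ext i
          refine Fin.addCases (fun i => ?_) (fun i => ?_) i
          · rw [e1, h1]; simp
          · rw [e2, h2]; simp
      rw [ite_zero_mul_ite_zero]
      exact if_congr key rfl rfl

lemma mem_oddIndices {N r : ℕ} {n : Fin r → ℕ} :
    n ∈ oddIndices N r ↔ ∑ i, n i = N ∧ ∀ i, 3 ≤ n i ∧ Odd (n i) := by
  simp [oddIndices, Finset.Nat.mem_antidiagonalTuple]

/-- All entries are at least 3, so the truncated subtraction in the exponents loses nothing. -/
lemma shiftedExponent_inj {N M r : ℕ} {m n : Fin r → ℕ} (hm : m ∈ oddIndices N r)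
    (hn : n ∈ oddIndices M r) (h : shiftedExponent m = shiftedExponent n) : m = n := by
  funext i
  have h1 := DFunLike.congr_fun h i
  have h2 := ((mem_oddIndices.1 hm).2 i).1
  have h3 := ((mem_oddIndices.1 hn).2 i).1
  simp only [shiftedExponent, Finsupp.equivFunOnFinite_symm_apply_apply] at h1
  omega

lemma coeff_shiftedExponent_monomial {N r : ℕ} (m n : OddIdx N r) :
    MvPolynomial.coeff (shiftedExponent n.1)
      (MvPolynomial.monomial (shiftedExponent m.1) (1 : ℚ)) = if m = n then 1 else 0 := by
  classical
  rw [MvPolynomial.coeff_monomial]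
  refine if_congr ⟨fun h => Subtype.ext (shiftedExponent_inj m.2 n.2 h), fun h => by rw [h]⟩ rfl rfl

/-- The coefficient vector map as a linear equivalence. -/
noncomputable def coeffEquiv (N r : ℕ) : evenPolys N r ≃ₗ[ℚ] OddVect N r :=
  LinearEquiv.ofBijective (coeffVector N r) <| by
    have hsum : ∀ P ∈ evenPolys N r, P = ∑ m : OddIdx N r,
        MvPolynomial.coeff (shiftedExponent m.1) P •
          MvPolynomial.monomial (shiftedExponent m.1) (1 : ℚ) := by
      intro P hP
      induction hP using Submodule.span_induction with
      | zero => simp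
      | add P Q _ _ hP hQ =>
        simp only [MvPolynomial.coeff_add, add_smul, Finset.sum_add_distrib]
        rw [← hP, ← hQ]
      | smul c P _ hP =>
        simp only [MvPolynomial.coeff_smul, smul_assoc, ← Finset.smul_sum]
        rw [← hP]
      | mem P hP =>
        obtain ⟨m, rfl⟩ := hP
        simp only [coeff_shiftedExponent_monomial, ite_smul, one_smul, zero_smul,
          Finset.sum_ite_eq, Finset.mem_univ, if_true]
    constructor
    · intro P Q h
      apply Subtype.ext
      rw [hsum P.1 P.2, hsum Q.1 Q.2]
      exact Finset.sum_congr rfl fun m _ => congrArg (· • _) (congrFun h m)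
    · intro v
      refine ⟨⟨∑ m : OddIdx N r, v m • MvPolynomial.monomial (shiftedExponent m.1) (1 : ℚ),
        Submodule.sum_mem _ fun m _ => Submodule.smul_mem _ _ (Submodule.subset_span ⟨m, rfl⟩)⟩, ?_⟩
      funext n
      simp only [coeffVector, LinearMap.coe_mk, AddHom.coe_mk, MvPolynomial.coeff_sum,
        MvPolynomial.coeff_smul, coeff_shiftedExponent_monomial, smul_eq_mul, mul_ite, mul_one,
        mul_zero, Finset.sum_ite_eq', Finset.mem_univ, if_true]

lemma coeffEquiv_apply {N r : ℕ} (P : evenPolys N r) (n : OddIdx N r) :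
    coeffEquiv N r P n = MvPolynomial.coeff (shiftedExponent n.1) P.1 := rfl

/-- The basis monomial of `evenPolys N r` with a given index. -/
noncomputable def evenMonomial {N r : ℕ} (m : OddIdx N r) : evenPolys N r :=
  ⟨MvPolynomial.monomial (shiftedExponent m.1) (1 : ℚ), Submodule.subset_span ⟨m, rfl⟩⟩

lemma coeffEquiv_evenMonomial {N r : ℕ} (m : OddIdx N r) :
    coeffEquiv N r (evenMonomial m) = Pi.single m 1 := by
  funext n
  rw [coeffEquiv_apply, evenMonomial, coeff_shiftedExponent_monomial, Pi.single_apply]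
  simp [eq_comm]

lemma evenPolys_eq_sum {N r : ℕ} (P : evenPolys N r) :
    P = ∑ m, coeffEquiv N r P m • evenMonomial m := by
  apply (coeffEquiv N r).injective
  simp only [map_sum, map_smul, coeffEquiv_evenMonomial]
  funext n
  simp [Finset.sum_apply, Pi.single_apply]

lemma evenPolys_hom_ext {N r : ℕ} {V : Type*} [AddCommGroup V] [Module ℚ V]
    {f g : evenPolys N r →ₗ[ℚ] V} (h : ∀ m, f (evenMonomial m) = g (evenMonomial m)) : f = g := by
  ext P
  rw [evenPolys_eq_sum P]
  simp [h]

instance (N r : ℕ) : FiniteDimensional ℚ (evenPolys N r) :=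
  (coeffEquiv N r).symm.finiteDimensional

lemma coeff_totallyEvenPart {r : ℕ} (Q : MvPolynomial (Fin r) ℚ) {d : Fin r →₀ ℕ}
    (hd : ∀ i, Even (d i) ∧ 2 ≤ d i) :
    MvPolynomial.coeff d (totallyEvenPart r Q) = MvPolynomial.coeff d Q := by
  classical
  simp only [totallyEvenPart, LinearMap.coe_mk, AddHom.coe_mk, MvPolynomial.coeff_sum,
    MvPolynomial.coeff_monomial, Finset.sum_ite_eq', Finset.mem_filter,
    MvPolynomial.mem_support_iff, hd, implies_true, and_true, ite_not]
  split_ifs with h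
  · exact h.symm
  · rfl

lemma shiftedExponent_even {N r : ℕ} (n : OddIdx N r) (i : Fin r) :
    Even (shiftedExponent n.1 i) ∧ 2 ≤ shiftedExponent n.1 i := by
  have h := (mem_oddIndices.1 n.2).2 i
  simp only [shiftedExponent, Finsupp.equivFunOnFinite_symm_apply_apply]
  obtain ⟨h1, c, hc⟩ := h
  exact ⟨⟨c, by omega⟩, by omega⟩

/-- Every coefficient read by π survives the truncation in φ_j, so the truncation can be ignored. -/
lemma coeffEquiv_phi {N r j : ℕ} (P : evenPolys N r) (n : OddIdx N r) :
    coeffEquiv N r (phi N r j P) n =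
      MvPolynomial.coeff (shiftedExponent n.1) (phiPoly r j P.1) := by
  rw [coeffEquiv_apply]
  exact coeff_totallyEvenPart _ (shiftedExponent_even n)

/-! ### The maps φ_j as multiplication by the matrices E^{(j)}. -/

lemma polyVar_natAdd (k j x : ℕ) (hx : 1 ≤ x) :
    polyVar (k + j) (k + x) = MvPolynomial.rename (Fin.natAdd k) (polyVar j x) := by
  unfold polyVar
  by_cases h : x - 1 < j
  · rw [dif_pos h, dif_pos (by omega), MvPolynomial.rename_X]
    congr 1
    ext
    simp
    omega
  · rw [dif_neg h, dif_neg (by omega), map_zero]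

lemma omitVar_natAdd (k j p x : ℕ) (hx : 1 ≤ x) :
    omitVar (k + j) (k + p) (k + x) = MvPolynomial.rename (Fin.natAdd k) (omitVar j p x) := by
  unfold omitVar
  by_cases h : x < p
  · rw [if_pos h, if_pos (by omega), polyVar_natAdd _ _ _ hx]
  · rw [if_neg h, if_neg (by omega), ← polyVar_natAdd _ _ _ (by omega), add_assoc]

lemma polyVar_castAdd (k j : ℕ) (i : Fin k) :
    polyVar (k + j) (i.val + 1) = MvPolynomial.rename (Fin.castAdd j) (MvPolynomial.X i) := by
  unfold polyVar
  rw [dif_pos (by omega), MvPolynomial.rename_X]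
  rfl

lemma aeval_monomial_one {σ A : Type*} [Fintype σ] [CommRing A] [Algebra ℚ A] (F : σ → A)
    (s : σ →₀ ℕ) : MvPolynomial.aeval F (MvPolynomial.monomial s (1 : ℚ)) = ∏ i, F i ^ s i := by
  rw [MvPolynomial.aeval_monomial, map_one, one_mul, Finsupp.prod_fintype _ _ (by simp)]

/-- With r = k + (l + 1) and j = l + 1, the substitution fixes the first k variables and mixes only
the last l + 1, so a monomial splits into an untouched head and a substituted tail. -/
lemma aeval_phiArg_monomial (k l i p : ℕ) (hi : 1 ≤ i) (s : Fin (k + (l + 1)) →₀ ℕ) :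
    MvPolynomial.aeval (fun x : Fin (k + (l + 1)) =>
        phiArg (k + (l + 1)) (l + 1) (k + i) (k + p) (x.val + 1))
        (MvPolynomial.monomial s (1 : ℚ)) =
      (∏ x : Fin k, MvPolynomial.rename (Fin.castAdd (l + 1)) (MvPolynomial.X x) ^
          s (Fin.castAdd (l + 1) x)) *
        MvPolynomial.rename (Fin.natAdd k)
          ((polyVar (l + 1) (i + 1) - polyVar (l + 1) i) ^ s (Fin.natAdd k 0) *
            ∏ x : Fin l, omitVar (l + 1) p (x.val + 1) ^ s (Fin.natAdd k x.succ)) := by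
  rw [aeval_monomial_one, Fin.prod_univ_add, Fin.prod_univ_succ]
  have hk : k + (l + 1) - (l + 1) = k := by omega
  congr 1
  · refine Finset.prod_congr rfl fun x _ => ?_
    rw [phiArg, if_pos (by simp), ← polyVar_castAdd]
    rfl
  · rw [map_mul, map_pow, map_prod, map_sub, ← polyVar_natAdd _ _ _ (by omega),
      ← polyVar_natAdd _ _ _ hi]
    congr 1
    · rw [phiArg, if_neg (by simp), if_pos (by simp), add_assoc]
    · refine Finset.prod_congr rfl fun x _ => ?_
      rw [map_pow, ← omitVar_natAdd _ _ _ _ (by omega), phiArg, if_neg (by simp),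
        if_neg (by simp)]
      rfl

/-- The exponent of x_{k+1} is even, so the sign (-1)^{deg f} is 1 and f(x_i - x_{i+1}) = f(x_{i+1}
- x_i). This turns the sum in φ_j into the Ihara action on the tail. -/
lemma phiPoly_monomial (k l : ℕ) (s : Fin (k + (l + 1)) →₀ ℕ) (hs : Even (s (Fin.natAdd k 0))) :
    phiPoly (k + (l + 1)) (l + 1) (MvPolynomial.monomial s 1) =
      (MvPolynomial.rename (Fin.castAdd (l + 1))
        (∏ x : Fin k, MvPolynomial.X x ^ s (Fin.castAdd (l + 1) x))) *
      MvPolynomial.rename (Fin.natAdd k) (iharaAction (l + 1) (Polynomial.X ^ s (Fin.natAdd k 0))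
        (∏ x : Fin l, MvPolynomial.X x ^ s (Fin.natAdd k x.succ))) := by
  have hk : k + (l + 1) - (l + 1) = k := by omega
  simp only [phiPoly, LinearMap.add_apply, LinearMap.id_apply, LinearMap.sum_apply,
    LinearMap.sub_apply, AlgHom.toLinearMap_apply, iharaAction, Polynomial.natDegree_X_pow,
    hs.neg_one_pow, one_mul, hk]
  have hneg : ∀ i, (polyVar (l + 1) i - polyVar (l + 1) (i + 1)) ^ s (Fin.natAdd k 0) =
      (polyVar (l + 1) (i + 1) - polyVar (l + 1) i) ^ s (Fin.natAdd k 0) := fun i => by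
    rw [← neg_sub, hs.neg_pow]
  simp only [map_prod, map_pow, MvPolynomial.aeval_X, Polynomial.aeval_X, hneg]
  rw [map_add, mul_add]
  congr 1
  -- The identity term of φ_j is the term f(x_1) g(x_2, …) of the Ihara action.
  · rw [← MvPolynomial.aeval_X_left_apply (MvPolynomial.monomial s (1 : ℚ)), aeval_monomial_one,
      Fin.prod_univ_add, Fin.prod_univ_succ, map_mul, map_pow, map_prod]
    congr 1
    · simp
    · congr 1
      · simp [polyVar]
      · refine Finset.prod_congr rfl fun x _ => ?_
        simp only [polyVar, map_pow]
        rw [dif_pos (by omega), MvPolynomial.rename_X]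
        rfl
  · rw [map_sum, Finset.mul_sum, ← Finset.map_add_left_Ico, Finset.sum_map]
    refine Finset.sum_congr rfl fun i hi => ?_
    have h1 := (Finset.mem_Ico.1 hi).1
    rw [addLeftEmbedding_apply, add_assoc k i 1, aeval_phiArg_monomial _ _ _ _ h1,
      aeval_phiArg_monomial _ _ _ _ h1]
    simp only [map_sub, map_mul, map_pow, map_prod]
    ring

lemma prod_X_pow_eq_monomial {k : ℕ} (s : Fin k → ℕ) :
    ∏ x, (MvPolynomial.X x : MvPolynomial (Fin k) ℚ) ^ s x =
      MvPolynomial.monomial (Finsupp.equivFunOnFinite.symm s) 1 := by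
  rw [← MvPolynomial.aeval_X_left_apply (MvPolynomial.monomial _ (1 : ℚ)), aeval_monomial_one]
  rfl

lemma tupleEntry_natAdd {k l x : ℕ} (m : Fin (k + l) → ℕ) (hx : x < l) :
    tupleEntry m (k + (x + 1)) = m (Fin.natAdd k ⟨x, hx⟩) := by
  unfold tupleEntry
  rw [dif_pos (by omega)]
  congr 1

/-- The untouched head produces the Kronecker delta of E^{(j)}, the Ihara action on the tail
produces the entry e. -/
lemma coeff_phiPoly_evenMonomial {N k l : ℕ} (m n : OddIdx N (k + (l + 1))) :
    MvPolynomial.coeff (shiftedExponent n.1) (phiPoly (k + (l + 1)) (l + 1) (evenMonomial m).1) =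
      matEj N (k + (l + 1)) (l + 1) m n := by
  classical
  rw [evenMonomial, phiPoly_monomial _ _ _ (shiftedExponent_even m _).1,
    coeff_rename_castAdd_mul_rename_natAdd, prod_X_pow_eq_monomial, MvPolynomial.coeff_monomial,
    ite_mul, one_mul, zero_mul, matEj, Matrix.of_apply]
  refine if_congr ?_ ?_ rfl
  · constructor
    · intro h i hi
      have hi' : i.val < k := by omega
      have h1 := DFunLike.congr_fun h ⟨i, hi'⟩
      have h2 := ((mem_oddIndices.1 m.2).2 i).1
      have h3 := ((mem_oddIndices.1 n.2).2 i).1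
      simp only [shiftedExponent, Finsupp.equivFunOnFinite_symm_apply_apply] at h1
      change m.1 i - 1 = n.1 i - 1 at h1
      omega
    · intro h
      ext i
      simp only [shiftedExponent, Finsupp.equivFunOnFinite_symm_apply_apply]
      rw [h _ (by simp)]
  · have hk : k + (l + 1) - (l + 1) = k := by omega
    have hm0 : tupleEntry m.1 (k + 1) = m.1 (Fin.natAdd k 0) :=
      tupleEntry_natAdd m.1 (Nat.succ_pos l)
    have hms : ∀ x : Fin l, tupleEntry m.1 (k + (x.val + 2)) = m.1 (Fin.natAdd k x.succ) :=
      fun x => tupleEntry_natAdd m.1 (Nat.succ_lt_succ x.2)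
    have hn : ∀ i : Fin (l + 1), tupleEntry n.1 (k + (i.val + 1)) = n.1 (Fin.natAdd k i) :=
      fun i => tupleEntry_natAdd n.1 i.2
    have hprod : ∏ x : Fin (l + 1 - 1), (MvPolynomial.X x : MvPolynomial (Fin (l + 1 - 1)) ℚ) ^
        (tupleEntry m.1 (k + (x.val + 2)) - 1) =
        ∏ x : Fin l, MvPolynomial.X x ^ (m.1 (Fin.natAdd k x.succ) - 1) :=
      Finset.prod_congr rfl fun x _ => by rw [hms x]
    rw [iharaCoeff, hk, hm0, hprod]
    simp only [hn, shiftedExponent, Finsupp.equivFunOnFinite_symm_apply_apply]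

lemma coeffEquiv_phi_eq_vecMul {N r j : ℕ} (hj : 1 ≤ j) (hjr : j ≤ r) (P : evenPolys N r) :
    coeffEquiv N r (phi N r j P) = Matrix.vecMul (coeffEquiv N r P) (matEj N r j) := by
  obtain ⟨l, rfl⟩ := Nat.exists_eq_add_of_le' hj
  obtain ⟨k, rfl⟩ := Nat.exists_eq_add_of_le' hjr
  have : (coeffEquiv N (k + (l + 1))).toLinearMap ∘ₗ phi N _ (l + 1) =
      (matEj N _ (l + 1)).vecMulLinear ∘ₗ (coeffEquiv N (k + (l + 1))).toLinearMap := by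
    refine evenPolys_hom_ext fun m => ?_
    simp only [LinearMap.comp_apply, LinearEquiv.coe_coe, Matrix.vecMulLinear_apply,
      coeffEquiv_evenMonomial, Matrix.single_one_vecMul]
    funext n
    rw [coeffEquiv_phi, coeff_phiPoly_evenMonomial]
    rfl
  exact LinearMap.congr_fun this P

lemma matEj_self (N r : ℕ) : matEj N r r = matE N r := by
  ext m n
  simp [matEj, matE]

/-- The product `E^{(2)} ⋯ E^{(j)}`. -/
noncomputable def matEprod (N r j : ℕ) : Matrix (OddIdx N r) (OddIdx N r) ℚ :=
  ((List.range' 2 (j - 1)).map (matEj N r)).prod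

lemma matEprod_succ {N r j : ℕ} (hj : 1 ≤ j) :
    matEprod N r (j + 1) = matEprod N r j * matEj N r (j + 1) := by
  obtain ⟨i, rfl⟩ := Nat.exists_eq_add_of_le' hj
  simp only [matEprod, Nat.add_sub_cancel]
  rw [List.range'_concat, List.map_append, List.prod_append]
  simp [show 2 + i = i + 1 + 1 by omega]

/-- Matrices act on row vectors from the right, so the map applied last gives the last factor of the
product. -/
lemma coeffEquiv_phiComp {N r j : ℕ} (hj : 1 ≤ j) (hjr : j ≤ r) (P : evenPolys N r) :
    coeffEquiv N r (phiComp N r j P) = Matrix.vecMul (coeffEquiv N r P) (matEprod N r j) := by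
  induction j, hj using Nat.le_induction with
  | base => simp [phiComp, matEprod]
  | succ j hj ih =>
    obtain ⟨i, rfl⟩ := Nat.exists_eq_add_of_le' hj
    rw [matEprod_succ hj, ← Matrix.vecMul_vecMul, ← ih (by omega),
      ← coeffEquiv_phi_eq_vecMul (by omega) hjr]
    rfl

lemma phiPoly_one (r : ℕ) (hr : 1 ≤ r) : phiPoly r 1 = LinearMap.id := by
  simp [phiPoly, Nat.sub_add_cancel hr]

/-- The sum in φ_1 is empty, so φ_1 is the identity. This settles depth one, where C_{N,1} = E_{N,1}
has to agree with an empty product. -/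
lemma matEj_one (N r : ℕ) (hr : 1 ≤ r) : matEj N r 1 = 1 := by
  ext m n
  have h := coeffEquiv_phi_eq_vecMul (N := N) le_rfl hr (evenMonomial m)
  rw [coeffEquiv_evenMonomial, Matrix.single_one_vecMul] at h
  have h2 := congrFun h n
  rw [coeffEquiv_phi, phiPoly_one r hr, LinearMap.id_apply, evenMonomial,
    coeff_shiftedExponent_monomial] at h2
  rw [Matrix.one_apply, h2]
  rfl

lemma matEprod_self {N r : ℕ} (hr : 1 ≤ r) : matEprod N r r = matC N r := by
  obtain ⟨i, rfl⟩ := Nat.exists_eq_add_of_le' hr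
  rcases Nat.eq_zero_or_pos i with rfl | hi
  · simp [matEprod, matC, ← matEj_self, matEj_one]
  · rw [matEprod_succ hi, matC, matEj_self]
    rfl

lemma rank_matC_eq {N r : ℕ} (hr : 1 ≤ r) :
    (matC N r).rank = Module.finrank ℚ (LinearMap.range (phiComp N r r)) := by
  rw [← matEprod_self hr, ← Matrix.finrank_range_vecMulLinear]
  have h : (matEprod N r r).vecMulLinear =
      (coeffEquiv N r).toLinearMap ∘ₗ phiComp N r r ∘ₗ (coeffEquiv N r).symm.toLinearMap := by
    refine LinearMap.ext fun v => ?_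
    simp [coeffEquiv_phiComp hr le_rfl]
  rw [h, LinearMap.range_comp, LinearMap.range_comp_of_range_eq_top _ (LinearEquiv.range _),
    LinearEquiv.finrank_map_eq]

/-! ### Slicing indices and vectors into heads and tails. -/

/-- The tuples with given head and tail form an index set. -/
lemma append_mem_oddIndices {N n k l : ℕ} (hn : n ≤ N) {a : Fin k → ℕ} {t : Fin l → ℕ}
    (ha : a ∈ oddIndices n k) (ht : t ∈ oddIndices (N - n) l) :
    Fin.append a t ∈ oddIndices N (k + l) := by
  rw [mem_oddIndices] at *
  refine ⟨?_, fun i => ?_⟩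
  · rw [Fin.sum_univ_add]
    simp only [Fin.append_left, Fin.append_right, ha.1, ht.1]
    omega
  · refine Fin.addCases (fun i => ?_) (fun i => ?_) i
    · simpa using ha.2 i
    · simpa using ht.2 i

/-- The index with given head and tail. -/
def OddIdx.append {N k l : ℕ} (n : Fin (N + 1)) (a : OddIdx n k) (t : OddIdx (N - n) l) :
    OddIdx N (k + l) :=
  ⟨Fin.append a.1 t.1, append_mem_oddIndices (Nat.le_of_lt_succ n.2) a.2 t.2⟩

lemma OddIdx.exists_append {N k l : ℕ} (m : OddIdx N (k + l)) :
    ∃ (n : Fin (N + 1)) (a : OddIdx n k) (t : OddIdx (N - n) l), m = OddIdx.append n a t := by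
  have h := mem_oddIndices.1 m.2
  rw [Fin.sum_univ_add] at h
  refine ⟨⟨∑ i, m.1 (Fin.castAdd l i), by omega⟩, ⟨fun i => m.1 (Fin.castAdd l i), ?_⟩,
    ⟨fun i => m.1 (Fin.natAdd k i), ?_⟩, ?_⟩
  · exact mem_oddIndices.2 ⟨rfl, fun i => h.2 _⟩
  · exact mem_oddIndices.2 ⟨by simp only; omega, fun i => h.2 _⟩
  · exact Subtype.ext (Fin.append_castAdd_natAdd).symm

lemma OddIdx.append_left {N k l : ℕ} {n : Fin (N + 1)} (a : OddIdx n k) (t : OddIdx (N - n) l)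
    (i : Fin k) : (OddIdx.append n a t).1 (Fin.castAdd l i) = a.1 i :=
  Fin.append_left _ _ _

lemma OddIdx.append_right {N k l : ℕ} {n : Fin (N + 1)} (a : OddIdx n k) (t : OddIdx (N - n) l)
    (i : Fin l) : (OddIdx.append n a t).1 (Fin.natAdd k i) = t.1 i :=
  Fin.append_right _ _ _

/-- The weight `n` is the sum of the head, hence determined by it. The conclusion lives in a sigma
type because `a` and `a'` have different types until `n = n'` is known. -/
lemma OddIdx.append_left_inj {N k l : ℕ} {n n' : Fin (N + 1)} {a : OddIdx n k} {a' : OddIdx n' k}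
    {t : OddIdx (N - n) l} {t' : OddIdx (N - n') l}
    (h : ∀ i, (OddIdx.append n a t).1 (Fin.castAdd l i) =
      (OddIdx.append n' a' t').1 (Fin.castAdd l i)) :
    (⟨n, a⟩ : Σ n : Fin (N + 1), OddIdx n k) = ⟨n', a'⟩ := by
  simp only [OddIdx.append_left] at h
  have hn : n = n' := by
    ext
    rw [← (mem_oddIndices.1 a.2).1, ← (mem_oddIndices.1 a'.2).1]
    exact Finset.sum_congr rfl fun i _ => h i
  subst hn
  rw [Subtype.ext (funext h)]

lemma OddIdx.append_right_inj {N k l : ℕ} {n n' : Fin (N + 1)} {a : OddIdx n k} {a' : OddIdx n' k}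
    {t : OddIdx (N - n) l} {t' : OddIdx (N - n') l}
    (h : ∀ i, (OddIdx.append n a t).1 (Fin.natAdd k i) =
      (OddIdx.append n' a' t').1 (Fin.natAdd k i)) :
    (⟨n, t⟩ : Σ n : Fin (N + 1), OddIdx (N - n) l) = ⟨n', t'⟩ := by
  simp only [OddIdx.append_right] at h
  have hn : n = n' := by
    have h1 := (mem_oddIndices.1 t.2).1
    have h2 := (mem_oddIndices.1 t'.2).1
    have h3 : ∑ i, t.1 i = ∑ i, t'.1 i := Finset.sum_congr rfl fun i _ => h i
    ext
    omega
  subst hn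
  rw [Subtype.ext (funext h)]

/-- Splitting an index into head and tail. -/
noncomputable def oddIdxEquiv (N k l : ℕ) :
    (Σ n : Fin (N + 1), OddIdx n k × OddIdx (N - n) l) ≃ OddIdx N (k + l) :=
  Equiv.ofBijective (fun x => OddIdx.append x.1 x.2.1 x.2.2) <| by
    constructor
    · rintro ⟨n, a, t⟩ ⟨n', a', t'⟩ h
      have h1 := OddIdx.append_left_inj (fun i => congrArg (fun m => m.1 (Fin.castAdd l i)) h)
      have h2 := OddIdx.append_right_inj (fun i => congrArg (fun m => m.1 (Fin.natAdd k i)) h)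
      cases h1
      cases h2
      rfl
    · intro m
      obtain ⟨n, a, t, rfl⟩ := m.exists_append
      exact ⟨⟨n, a, t⟩, rfl⟩

/-- Slicing a vector along heads and tails. -/
noncomputable def sliceEquiv (N k l : ℕ) :
    OddVect N (k + l) ≃ₗ[ℚ] (∀ n : Fin (N + 1), OddIdx n k → OddIdx (N - n) l → ℚ) where
  toFun v n a t := v (OddIdx.append n a t)
  map_add' _ _ := rfl
  map_smul' _ _ := rfl
  invFun u m := u ((oddIdxEquiv N k l).symm m).1 ((oddIdxEquiv N k l).symm m).2.1
    ((oddIdxEquiv N k l).symm m).2.2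
  left_inv v := by
    funext m
    exact congrArg v ((oddIdxEquiv N k l).apply_symm_apply m)
  right_inv u := by
    funext n a t
    have : (oddIdxEquiv N k l).symm (OddIdx.append n a t) = ⟨n, a, t⟩ :=
      (oddIdxEquiv N k l).symm_apply_apply ⟨n, a, t⟩
    -- The types of the arguments of `u` depend on `n`, so the triple has to be replaced as a whole.
    have key : ∀ x y : (Σ n : Fin (N + 1), OddIdx n k × OddIdx (N - n) l), x = y →
        u x.1 x.2.1 x.2.2 = u y.1 y.2.1 y.2.2 := by
      rintro x _ rfl
      rfl
    exact key _ _ this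

lemma iharaCoeff_congr {j : ℕ} {m m' n n' : ℕ → ℕ} (hm : ∀ i, 1 ≤ i → i ≤ j → m i = m' i)
    (hn : ∀ i, 1 ≤ i → i ≤ j → n i = n' i) (hj : 1 ≤ j) :
    iharaCoeff j m n = iharaCoeff j m' n' := by
  unfold iharaCoeff
  rw [hm 1 le_rfl hj]
  congr 2
  · funext i
    rw [hn _ (by omega) (by omega)]
  · refine Finset.prod_congr rfl fun x _ => ?_
    rw [hm _ (by omega) (by omega)]

lemma tupleEntry_append {N k l j x : ℕ} {n : Fin (N + 1)} (a : OddIdx n k)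
    (t : OddIdx (N - n) l) (hj : j ≤ l) (hx : 1 ≤ x) (hxj : x ≤ j) :
    tupleEntry (OddIdx.append n a t).1 (k + l - j + x) = tupleEntry t.1 (l - j + x) := by
  obtain ⟨y, rfl⟩ := Nat.exists_eq_add_of_le' hx
  rw [show k + l - j + (y + 1) = k + (l - j + y + 1) by omega, tupleEntry_natAdd _ (by omega),
    OddIdx.append_right, tupleEntry, dif_pos (by omega)]
  rfl

/-- As j ≤ l, the whole head falls under the Kronecker delta and e reads only entries of the tails.
-/
lemma matEj_append_append {N k l j : ℕ} (hj : 1 ≤ j) (hjl : j ≤ l) {n : Fin (N + 1)}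
    (a : OddIdx n k) (t t' : OddIdx (N - n) l) :
    matEj N (k + l) j (OddIdx.append n a t) (OddIdx.append n a t') = matEj (N - n) l j t t' := by
  simp only [matEj, Matrix.of_apply]
  refine if_congr ?_ (iharaCoeff_congr (fun i h1 h2 => tupleEntry_append a t hjl h1 h2)
    (fun i h1 h2 => tupleEntry_append a t' hjl h1 h2) hj) rfl
  constructor
  · intro h i hi
    have := h (Fin.natAdd k i) (by simp only [Fin.val_natAdd]; omega)
    simpa only [OddIdx.append_right] using this
  · intro h i
    refine Fin.addCases (fun i => ?_) (fun i => ?_) i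
    · intro _
      rw [OddIdx.append_left, OddIdx.append_left]
    · intro hi
      rw [OddIdx.append_right, OddIdx.append_right]
      exact h i (by simp only [Fin.val_natAdd] at hi; omega)

/-- E^{(j)} is block diagonal with respect to the head, and its blocks depend on the head only
through its weight. -/
lemma sliceEquiv_vecMul_matEj {N k l j : ℕ} (hj : 1 ≤ j) (hjl : j ≤ l) (v : OddVect N (k + l))
    (n : Fin (N + 1)) (a : OddIdx n k) :
    sliceEquiv N k l (Matrix.vecMul v (matEj N (k + l) j)) n a =
      Matrix.vecMul (sliceEquiv N k l v n a) (matEj (N - n) l j) := by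
  funext t'
  symm
  change ∑ t, sliceEquiv N k l v n a t * matEj (N - n) l j t t' =
    ∑ m, v m * matEj N (k + l) j m (OddIdx.append n a t')
  refine Fintype.sum_of_injective (fun t => OddIdx.append n a t) ?_ _ _ ?_ ?_
  · intro t t' h
    have := OddIdx.append_right_inj (fun i => congrArg (fun m => m.1 (Fin.natAdd k i)) h)
    cases this
    rfl
  -- An index with another head contributes zero, since the Kronecker delta vanishes.
  · intro m hm
    obtain ⟨n', a', t, rfl⟩ := m.exists_append
    simp only [matEj, Matrix.of_apply]
    rw [if_neg, mul_zero]
    intro h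
    have := OddIdx.append_left_inj (fun i => h (Fin.castAdd l i)
      (by simp only [Fin.val_castAdd]; omega))
    cases this
    exact hm ⟨t, rfl⟩
  · intro t
    rw [matEj_append_append hj hjl]
    rfl

lemma sliceEquiv_vecMul_matEprod {N k l j : ℕ} (hj : 1 ≤ j) (hjl : j ≤ l) (v : OddVect N (k + l))
    (n : Fin (N + 1)) (a : OddIdx n k) :
    sliceEquiv N k l (Matrix.vecMul v (matEprod N (k + l) j)) n a =
      Matrix.vecMul (sliceEquiv N k l v n a) (matEprod (N - n) l j) := by
  induction j, hj using Nat.le_induction with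
  | base => simp [matEprod]
  | succ j hj ih =>
    rw [matEprod_succ hj, matEprod_succ hj, ← Matrix.vecMul_vecMul, ← Matrix.vecMul_vecMul,
      sliceEquiv_vecMul_matEj (by omega) hjl, ih (by omega)]

/-- The slices of the coefficient vector of a polynomial. -/
noncomputable def coeffSliceEquiv (N k l : ℕ) :
    evenPolys N (k + l) ≃ₗ[ℚ] (∀ n : Fin (N + 1), OddIdx n k → OddIdx (N - n) l → ℚ) :=
  (coeffEquiv N (k + l)).trans (sliceEquiv N k l)

lemma coeffSliceEquiv_apply {N k l : ℕ} (P : evenPolys N (k + l)) (n : Fin (N + 1))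
    (a : OddIdx n k) (t : OddIdx (N - n) l) :
    coeffSliceEquiv N k l P n a t = coeffEquiv N (k + l) P (OddIdx.append n a t) := rfl

/-- For j = l the blocks of E^{(2)} ⋯ E^{(j)} are the full matrices C_{N-n,l}. -/
lemma coeffSliceEquiv_phiComp {N k l : ℕ} (hl : 1 ≤ l) (P : evenPolys N (k + l))
    (n : Fin (N + 1)) (a : OddIdx n k) :
    coeffSliceEquiv N k l (phiComp N (k + l) l P) n a =
      Matrix.vecMul (coeffSliceEquiv N k l P n a) (matC (N - n) l) := by
  rw [← matEprod_self hl]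
  simp only [coeffSliceEquiv, LinearEquiv.trans_apply]
  rw [coeffEquiv_phiComp hl (by omega), sliceEquiv_vecMul_matEprod hl le_rfl]

/-- Heads of length one with no condition on the slices: this yields the factor 𝕆. -/
lemma finrank_range_phiComp {N l : ℕ} (hl : 1 ≤ l) :
    Module.finrank ℚ (LinearMap.range (phiComp N (1 + l) l)) =
      ∑ n : Fin (N + 1), Fintype.card (OddIdx n 1) * (matC (N - n) l).rank := by
  have h := finrank_map_of_slices
    (fun n : Fin (N + 1) => (⊤ : Submodule ℚ (OddIdx n 1 → ℚ))) (fun n : Fin (N + 1) => matC (N - n) l)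
    (coeffSliceEquiv N 1 l) ⊤ (by simp) (phiComp N (1 + l) l)
    (fun P n a => coeffSliceEquiv_phiComp hl P n a)
  rw [← LinearMap.range_eq_map] at h
  simpa using h

/-! ### The spaces W_{N,r} as sums of copies of the W_{n,2}. -/

/-- The substitution `(x_2 - x_1, y, x_3, …, x_r)` with `y = x_p`. -/
noncomputable def periodArg (r p : ℕ) (k : Fin r) : MvPolynomial (Fin r) ℚ :=
  if k.val = 0 then polyVar r 2 - polyVar r 1
  else if k.val = 1 then polyVar r p else polyVar r (k.val + 1)

/-- The defect `P - P(x_2 - x_1, x_2, x_3, …) + P(x_2 - x_1, x_1, x_3, …)` of the defining relation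
of `periodPolys`. -/
noncomputable def periodDefect (r : ℕ) : MvPolynomial (Fin r) ℚ →ₗ[ℚ] MvPolynomial (Fin r) ℚ :=
  (MvPolynomial.aeval MvPolynomial.X).toLinearMap -
    ((MvPolynomial.aeval (periodArg r 2)).toLinearMap -
      (MvPolynomial.aeval (periodArg r 1)).toLinearMap)

lemma mem_periodPolys {N r : ℕ} {P : evenPolys N r} :
    P ∈ periodPolys N r ↔ P.1 = MvPolynomial.aeval (periodArg r 2) P.1 -
      MvPolynomial.aeval (periodArg r 1) P.1 := Iff.rfl

lemma mem_periodPolys_iff_periodDefect {N r : ℕ} {P : evenPolys N r} :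
    P ∈ periodPolys N r ↔ periodDefect r P.1 = 0 := by
  rw [mem_periodPolys]
  simp only [periodDefect, LinearMap.sub_apply, AlgHom.toLinearMap_apply,
    MvPolynomial.aeval_X_left_apply, sub_eq_zero]

lemma aeval_monomial_eq_rename_mul_rename {k l : ℕ} (F : Fin (k + l) → MvPolynomial (Fin (k + l)) ℚ)
    (G : Fin k → MvPolynomial (Fin k) ℚ)
    (hF : ∀ i, F (Fin.castAdd l i) = MvPolynomial.rename (Fin.castAdd l) (G i))
    (hF' : ∀ i, F (Fin.natAdd k i) = MvPolynomial.X (Fin.natAdd k i)) (s : Fin (k + l) →₀ ℕ) :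
    MvPolynomial.aeval F (MvPolynomial.monomial s (1 : ℚ)) =
      MvPolynomial.rename (Fin.castAdd l) (MvPolynomial.aeval G (MvPolynomial.monomial
        (Finsupp.equivFunOnFinite.symm fun i => s (Fin.castAdd l i)) (1 : ℚ))) *
      MvPolynomial.rename (Fin.natAdd k) (MvPolynomial.monomial
        (Finsupp.equivFunOnFinite.symm fun i => s (Fin.natAdd k i)) (1 : ℚ)) := by
  rw [aeval_monomial_one, aeval_monomial_one, Fin.prod_univ_add, ← prod_X_pow_eq_monomial]
  simp [hF, hF']

lemma periodArg_castAdd {l p : ℕ} (hp : 1 ≤ p) (hp2 : p ≤ 2) (i : Fin 2) :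
    periodArg (2 + l) p (Fin.castAdd l i) =
      MvPolynomial.rename (Fin.castAdd l) (periodArg 2 p i) := by
  have h : ∀ q, 1 ≤ q → q ≤ 2 → polyVar (2 + l) q =
      MvPolynomial.rename (Fin.castAdd l) (polyVar 2 q) := by
    intro q h1 h2
    unfold polyVar
    rw [dif_pos (by omega), dif_pos (by omega), MvPolynomial.rename_X]
    rfl
  fin_cases i
  · simp [periodArg, h]
  · simp [periodArg, h p hp hp2]

lemma periodArg_natAdd {l p : ℕ} (i : Fin l) :
    periodArg (2 + l) p (Fin.natAdd 2 i) = MvPolynomial.X (Fin.natAdd 2 i) := by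
  unfold periodArg polyVar
  rw [if_neg (by simp), if_neg (by simp only [Fin.val_natAdd]; omega),
    dif_pos (by simp)]
  rfl

/-- The substitutions in the period relation fix x_3, …, x_r, so the defect only affects the head of
length two. -/
lemma periodDefect_monomial {l : ℕ} (s : Fin (2 + l) →₀ ℕ) :
    periodDefect (2 + l) (MvPolynomial.monomial s 1) =
      MvPolynomial.rename (Fin.castAdd l) (periodDefect 2 (MvPolynomial.monomial
        (Finsupp.equivFunOnFinite.symm fun i => s (Fin.castAdd l i)) 1)) *
      MvPolynomial.rename (Fin.natAdd 2) (MvPolynomial.monomial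
        (Finsupp.equivFunOnFinite.symm fun i => s (Fin.natAdd 2 i)) 1) := by
  simp only [periodDefect, LinearMap.sub_apply, AlgHom.toLinearMap_apply, map_sub, sub_mul]
  rw [aeval_monomial_eq_rename_mul_rename _ _ (periodArg_castAdd one_le_two le_rfl)
      periodArg_natAdd,
    aeval_monomial_eq_rename_mul_rename _ _ (periodArg_castAdd le_rfl one_le_two)
      periodArg_natAdd,
    aeval_monomial_eq_rename_mul_rename MvPolynomial.X MvPolynomial.X (by simp) (by simp)]

lemma coeff_periodDefect {N l : ℕ} (P : evenPolys N (2 + l)) (D : Fin (2 + l) →₀ ℕ) :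
    MvPolynomial.coeff D (periodDefect (2 + l) P.1) = ∑ m, coeffEquiv N (2 + l) P m *
      (MvPolynomial.coeff (Finsupp.equivFunOnFinite.symm fun i => D (Fin.castAdd l i))
        (periodDefect 2 (MvPolynomial.monomial
          (shiftedExponent fun i => m.1 (Fin.castAdd l i)) 1)) *
      if (shiftedExponent fun i => m.1 (Fin.natAdd 2 i)) =
        (Finsupp.equivFunOnFinite.symm fun i => D (Fin.natAdd 2 i)) then 1 else 0) := by
  classical
  conv_lhs => rw [evenPolys_eq_sum P]
  simp only [Submodule.coe_sum, Submodule.coe_smul, map_sum, map_smul, MvPolynomial.coeff_sum,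
    MvPolynomial.coeff_smul, evenMonomial, smul_eq_mul, periodDefect_monomial,
    coeff_rename_castAdd_mul_rename_natAdd]
  refine Finset.sum_congr rfl fun m _ => ?_
  congr 2
  rw [MvPolynomial.coeff_monomial]
  rfl

lemma coeff_periodDefect_slice {N l : ℕ} (P : evenPolys N (2 + l)) (n : Fin (N + 1))
    (t : OddIdx (N - n) l) (D : Fin (2 + l) →₀ ℕ)
    (hD : (Finsupp.equivFunOnFinite.symm fun i => D (Fin.natAdd 2 i)) = shiftedExponent t.1) :
    MvPolynomial.coeff D (periodDefect (2 + l) P.1) =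
      MvPolynomial.coeff (Finsupp.equivFunOnFinite.symm fun i => D (Fin.castAdd l i))
        (periodDefect 2 ((coeffEquiv n 2).symm fun a => coeffSliceEquiv N 2 l P n a t).1) := by
  rw [coeff_periodDefect, hD]
  conv_rhs => rw [evenPolys_eq_sum ((coeffEquiv n 2).symm fun a => coeffSliceEquiv N 2 l P n a t)]
  simp only [Submodule.coe_sum, Submodule.coe_smul, map_sum, map_smul, MvPolynomial.coeff_sum,
    MvPolynomial.coeff_smul, evenMonomial, smul_eq_mul, LinearEquiv.apply_symm_apply]
  symm
  refine Fintype.sum_of_injective (fun a => OddIdx.append n a t) ?_ _ _ ?_ ?_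
  · intro a a' h
    have := OddIdx.append_left_inj (fun i => congrArg (fun m => m.1 (Fin.castAdd l i)) h)
    cases this
    rfl
  · intro m hm
    obtain ⟨n', a', t', rfl⟩ := m.exists_append
    rw [if_neg, mul_zero, mul_zero]
    intro h
    simp only [OddIdx.append_right] at h
    have ht := shiftedExponent_inj t'.2 t.2 h
    have hn : n' = n := by
      have h1 := (mem_oddIndices.1 t'.2).1
      have h2 := (mem_oddIndices.1 t.2).1
      simp only [ht] at h1
      ext
      omega
    subst hn
    rw [← Subtype.ext ht] at hm
    exact hm ⟨a', rfl⟩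
  · intro a
    simp only [OddIdx.append_right, OddIdx.append_left]
    rw [if_pos trivial, mul_one, coeffSliceEquiv_apply]

/-- The period relation can be compared one tail monomial at a time, and for each tail it is the
relation in depth two. -/
lemma mem_periodPolys_iff_slices {N l : ℕ} (P : evenPolys N (2 + l)) :
    P ∈ periodPolys N (2 + l) ↔ ∀ (n : Fin (N + 1)) (t : OddIdx (N - n) l),
      (fun a => coeffSliceEquiv N 2 l P n a t) ∈
        (periodPolys n 2).map (coeffEquiv n 2).toLinearMap := by
  have hmem : ∀ (n : Fin (N + 1)) (v : OddVect n 2),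
      v ∈ (periodPolys n 2).map (coeffEquiv n 2).toLinearMap ↔
      periodDefect 2 ((coeffEquiv n 2).symm v).1 = 0 := by
    intro n v
    rw [Submodule.mem_map_equiv, mem_periodPolys_iff_periodDefect]
  simp only [hmem]
  rw [mem_periodPolys_iff_periodDefect]
  constructor
  · intro h n t
    ext d
    have := coeff_periodDefect_slice P n t
      (Finsupp.equivFunOnFinite.symm (Fin.append (fun i => d i) (fun i => shiftedExponent t.1 i)))
      (by ext i; simp)
    rw [h, MvPolynomial.coeff_zero] at this
    rw [MvPolynomial.coeff_zero, this]
    congr 1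
    ext i
    simp
  · intro h
    ext D
    rw [MvPolynomial.coeff_zero]
    by_cases hD : ∃ (n : Fin (N + 1)) (t : OddIdx (N - n) l),
        (Finsupp.equivFunOnFinite.symm fun i => D (Fin.natAdd 2 i)) = shiftedExponent t.1
    · obtain ⟨n, t, ht⟩ := hD
      rw [coeff_periodDefect_slice P n t D ht, h, MvPolynomial.coeff_zero]
    -- No monomial of `P` has such a tail exponent, and the defect creates no new tails.
    · rw [coeff_periodDefect]
      refine Finset.sum_eq_zero fun m _ => ?_
      obtain ⟨n, a, t, rfl⟩ := m.exists_append
      rw [if_neg, mul_zero, mul_zero]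
      intro hm
      simp only [OddIdx.append_right] at hm
      exact hD ⟨n, t, hm.symm⟩

/-- The condition concerns the first two variables and the maps concern the last l, so the
dimensions multiply in each weight: this yields the factor 𝕊. -/
lemma finrank_map_phiComp_periodPolys {N l : ℕ} (hl : 1 ≤ l) :
    Module.finrank ℚ ((periodPolys N (2 + l)).map (phiComp N (2 + l) l)) =
      ∑ n : Fin (N + 1), Module.finrank ℚ (periodPolys n 2) * (matC (N - n) l).rank := by
  rw [finrank_map_of_slices
    (fun n : Fin (N + 1) => (periodPolys n 2).map (coeffEquiv n 2).toLinearMap)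
    (fun n : Fin (N + 1) => matC (N - n) l)
    (coeffSliceEquiv N 2 l) (periodPolys N (2 + l)) mem_periodPolys_iff_slices
    (phiComp N (2 + l) l) (fun P n a => coeffSliceEquiv_phiComp hl P n a)]
  exact Finset.sum_congr rfl fun n _ => by rw [LinearEquiv.finrank_map_eq]

/-- Needed so that Tasaka's map can be applied to the image. -/
lemma map_phiComp_periodPolys_le {N l : ℕ} (hl : 1 ≤ l) :
    (periodPolys N (2 + l)).map (phiComp N (2 + l) l) ≤ periodPolys N (2 + l) :=
  map_le_of_slices
    (fun n : Fin (N + 1) => (periodPolys n 2).map (coeffEquiv n 2).toLinearMap)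
    (fun n : Fin (N + 1) => matC (N - n) l)
    (coeffSliceEquiv N 2 l) (periodPolys N (2 + l)) mem_periodPolys_iff_slices
    (phiComp N (2 + l) l) (fun P n a => coeffSliceEquiv_phiComp hl P n a)

/-! ### Tasaka's map on W_{N,r} in terms of φ_{r-1}. -/

lemma aeval_aeval {σ τ A : Type*} [CommRing A] [Algebra ℚ A] (G : τ → A)
    (F : σ → MvPolynomial τ ℚ) (p : MvPolynomial σ ℚ) :
    MvPolynomial.aeval G (MvPolynomial.aeval F p) =
      MvPolynomial.aeval (fun i => MvPolynomial.aeval G (F i)) p := by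
  rw [← AlgHom.comp_apply, MvPolynomial.comp_aeval]

/-- A substitution into an even polynomial does not see the signs of the arguments. -/
lemma aeval_congr_sign {N r : ℕ} (P : evenPolys N r) {A : Type*} [CommRing A] [Algebra ℚ A]
    {F G : Fin r → A} (h : ∀ i, F i = G i ∨ F i = -G i) :
    MvPolynomial.aeval F P.1 = MvPolynomial.aeval G P.1 := by
  have : (MvPolynomial.aeval F).toLinearMap ∘ₗ (evenPolys N r).subtype =
      (MvPolynomial.aeval G).toLinearMap ∘ₗ (evenPolys N r).subtype := by
    refine evenPolys_hom_ext fun m => ?_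
    simp only [LinearMap.comp_apply, Submodule.subtype_apply, AlgHom.toLinearMap_apply,
      evenMonomial, aeval_monomial_one]
    refine Finset.prod_congr rfl fun i _ => ?_
    rcases h i with h | h
    · rw [h]
    · rw [h, (shiftedExponent_even m i).1.neg_pow]
  exact LinearMap.congr_fun this P

/-- Period polynomials are antisymmetric in the first two arguments. -/
lemma periodPolys_antisymm {N l : ℕ} {P : evenPolys N (l + 2)} (hP : P ∈ periodPolys N (l + 2))
    {A : Type*} [CommRing A] [Algebra ℚ A] (F : Fin (l + 2) → A) :
    MvPolynomial.aeval (F ∘ Equiv.swap 0 1) P.1 = -MvPolynomial.aeval F P.1 := by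
  have key : ∀ G : Fin (l + 2) → A, MvPolynomial.aeval G P.1 =
      MvPolynomial.aeval (Fin.cons (G 1 - G 0) (Fin.cons (G 1) fun i => G i.succ.succ) :
        Fin (l + 2) → A) P.1 -
      MvPolynomial.aeval (Fin.cons (G 1 - G 0) (Fin.cons (G 0) fun i => G i.succ.succ) :
        Fin (l + 2) → A) P.1 := by
    intro G
    conv_lhs => rw [mem_periodPolys.1 hP, map_sub]
    rw [aeval_aeval, aeval_aeval]
    congr 3
    all_goals
      funext i
      refine Fin.cases ?_ (fun i => Fin.cases ?_ (fun i => ?_) i) i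
      · simp [periodArg, polyVar]
      · simp [periodArg, polyVar]
      · simp only [periodArg, polyVar, Fin.val_succ, Fin.cons_succ]
        rw [if_neg (by omega), if_neg (by omega), dif_pos (by omega), MvPolynomial.aeval_X]
        rfl
  -- Swapping the first two arguments swaps the two terms of the relation, up to the sign of x_2 -
  -- x_1, which an even polynomial does not see.
  rw [key, key F, neg_sub]
  congr 1
  all_goals
    refine aeval_congr_sign P fun i => ?_
    refine Fin.cases ?_ (fun i => Fin.cases ?_ (fun i => ?_) i) i
    · right; simp
    · left; simp
    · left
      simp only [Fin.cons_succ, Function.comp_apply]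
      rw [Equiv.swap_apply_of_ne_of_ne (by simp) (by simp [Fin.ext_iff])]

/-- In φ_r the term i = 1 is -P by the period relation. The terms i ≥ 2 are those of φ_{r-1} with
the first two arguments exchanged, so antisymmetry makes them opposite. -/
lemma phiPoly_periodPolys {N l : ℕ} {P : evenPolys N (l + 3)} (hP : P ∈ periodPolys N (l + 3)) :
    phiPoly (l + 3) (l + 3) P.1 - P.1 = -phiPoly (l + 3) (l + 2) P.1 := by
  have h1 : l + 3 - (l + 3) = 0 := by omega
  have h2 : l + 3 - (l + 2) = 1 := by omega
  simp only [phiPoly, LinearMap.add_apply, LinearMap.id_apply, LinearMap.sum_apply,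
    LinearMap.sub_apply, AlgHom.toLinearMap_apply, h1, h2]
  rw [Finset.sum_eq_sum_Ico_succ_bot (by omega)]
  have hfirst : MvPolynomial.aeval (fun k : Fin (l + 3) =>
      phiArg (l + 3) (l + 3) (0 + 1) (0 + 1 + 1) (k.val + 1)) P.1 -
      MvPolynomial.aeval (fun k : Fin (l + 3) =>
        phiArg (l + 3) (l + 3) (0 + 1) (0 + 1) (k.val + 1)) P.1 = -P.1 := by
    conv_rhs => rw [mem_periodPolys.1 hP, neg_sub]
    congr 3
    all_goals
      funext k
      simp only [phiArg, periodArg, omitVar, h1]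
      refine Fin.cases ?_ (fun i => Fin.cases ?_ (fun i => ?_) i) k
      · simp
      · simp
      · simp only [Fin.val_succ]
        rw [if_neg (by omega), if_neg (by omega), if_neg (by omega), if_neg (by omega),
          if_neg (by omega)]
        congr 1
  -- The condition 2 ≤ p keeps x_1 among the arguments: it stands second in φ_r and first in
  -- φ_{r-1}.
  have hrest : ∀ i p, 2 ≤ p → MvPolynomial.aeval (fun k : Fin (l + 3) =>
      phiArg (l + 3) (l + 3) i p (k.val + 1)) P.1 =
      -MvPolynomial.aeval (fun k : Fin (l + 3) =>
        phiArg (l + 3) (l + 2) i p (k.val + 1)) P.1 := by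
    intro i p hp
    rw [← periodPolys_antisymm hP]
    congr 2
    funext k
    simp only [phiArg, omitVar, h1, h2, Function.comp_apply]
    refine Fin.cases ?_ (fun i => Fin.cases ?_ (fun i => ?_) i) k
    · simp
    · have : 1 < p := by omega
      simp [this]
    · have hi : i.succ.succ ≠ 1 := fun h => Fin.succ_ne_zero i (Fin.succ_injective _ h)
      rw [Equiv.swap_apply_of_ne_of_ne (Fin.succ_ne_zero _) hi]
      simp only [Fin.val_succ]
      rw [if_neg (show ¬i.val + 1 + 1 + 1 ≤ 0 by omega),
        if_neg (show ¬i.val + 1 + 1 + 1 = 0 + 1 by omega),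
        if_neg (show ¬i.val + 1 + 1 + 1 ≤ 1 by omega),
        if_neg (show ¬i.val + 1 + 1 + 1 = 1 + 1 by omega)]
  rw [hfirst]
  have hsum : ∑ i ∈ Finset.Ico (0 + 1 + 1) (l + 3),
      (MvPolynomial.aeval (fun k : Fin (l + 3) =>
        phiArg (l + 3) (l + 3) i (i + 1) (k.val + 1)) P.1 -
      MvPolynomial.aeval (fun k : Fin (l + 3) =>
        phiArg (l + 3) (l + 3) i i (k.val + 1)) P.1) =
      -∑ i ∈ Finset.Ico (1 + 1) (l + 3),
      (MvPolynomial.aeval (fun k : Fin (l + 3) =>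
        phiArg (l + 3) (l + 2) i (i + 1) (k.val + 1)) P.1 -
      MvPolynomial.aeval (fun k : Fin (l + 3) =>
        phiArg (l + 3) (l + 2) i i (k.val + 1)) P.1) := by
    rw [← Finset.sum_neg_distrib]
    refine Finset.sum_congr rfl fun i hi => ?_
    have := (Finset.mem_Ico.1 hi).1
    rw [hrest i _ (by omega), hrest i i (by omega)]
    ring
  rw [hsum]
  ring

/-- Since π(P)E_{N,r} = π(φ_r P), the previous identity applies. For r ≥ 3 injectivity of Tasaka's
map thus means that φ_{r-1} is injective on W_{N,r}. -/
lemma tasakaMap_eq {N l : ℕ} (P : periodPolys N (l + 3)) :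
    tasakaMap N (l + 3) P = -coeffEquiv N (l + 3) (phi N (l + 3) (l + 2) P.1) := by
  have h : tasakaMap N (l + 3) P = coeffEquiv N (l + 3) (phi N (l + 3) (l + 3) P.1) -
      coeffEquiv N (l + 3) P.1 := by
    rw [coeffEquiv_phi_eq_vecMul (by omega) le_rfl, matEj_self]
    simp only [tasakaMap, LinearMap.comp_apply, Matrix.vecMulLinear_apply, Matrix.vecMul_sub,
      Matrix.vecMul_one]
    rfl
  rw [h]
  funext n
  rw [Pi.sub_apply, Pi.neg_apply, coeffEquiv_phi, coeffEquiv_phi, coeffEquiv_apply,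
    ← MvPolynomial.coeff_sub, phiPoly_periodPolys P.2, MvPolynomial.coeff_neg]

/-- The image under the shorter composite stays in W_{N,r}, where φ_{r-1} is injective. -/
lemma finrank_map_phiComp_succ_periodPolys (h_inj : TasakaInjectivity) {N l : ℕ} (hN : 0 < N) :
    Module.finrank ℚ ((periodPolys N (l + 3)).map (phiComp N (l + 3) (l + 2))) =
      Module.finrank ℚ ((periodPolys N (l + 3)).map (phiComp N (l + 3) (l + 1))) := by
  have hle : (periodPolys N (l + 3)).map (phiComp N (l + 3) (l + 1)) ≤ periodPolys N (l + 3) := by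
    have := map_phiComp_periodPolys_le (N := N) (l := l + 1) (by omega)
    rwa [show 2 + (l + 1) = l + 3 by omega] at this
  rw [show phiComp N (l + 3) (l + 2) = phi N (l + 3) (l + 2) ∘ₗ phiComp N (l + 3) (l + 1) from rfl,
    Submodule.map_comp]
  have hdisj : ∀ P ∈ (periodPolys N (l + 3)).map (phiComp N (l + 3) (l + 1)),
      phi N (l + 3) (l + 2) P = 0 → P = 0 := by
    intro P hP h0
    have h1 : tasakaMap N (l + 3) ⟨P, hle hP⟩ = tasakaMap N (l + 3) 0 := by
      rw [tasakaMap_eq, h0, map_zero, map_zero, neg_zero]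
    exact congrArg Subtype.val (h_inj (l + 3) N (by omega) hN h1)
  set U := (periodPolys N (l + 3)).map (phiComp N (l + 3) (l + 1))
  rw [← LinearMap.range_domRestrict]
  refine LinearMap.finrank_range_of_inj ((injective_iff_map_eq_zero _).2 fun P h => ?_)
  exact Subtype.ext (hdisj P.1 P.2 h)

/-! ### Depth two: the kernel of φ_2. -/

open MvPolynomial in
lemma aeval_aeval_pair {A : Type*} [CommRing A] [Algebra ℚ A] (G : Fin 2 → A)
    (a b : MvPolynomial (Fin 2) ℚ) (p : MvPolynomial (Fin 2) ℚ) :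
    aeval G (aeval ![a, b] p) = aeval ![aeval G a, aeval G b] p := by
  rw [aeval_aeval]
  congr 2
  funext i
  fin_cases i <;> rfl

/-- The substitution `p(x, y) ↦ p(y, x)`. -/
noncomputable def swapVars : MvPolynomial (Fin 2) ℚ →ₐ[ℚ] MvPolynomial (Fin 2) ℚ :=
  MvPolynomial.aeval ![MvPolynomial.X 1, MvPolynomial.X 0]

/-- The substitution `p(x, y) ↦ p(x - y, x)`. -/
noncomputable def rotVars : MvPolynomial (Fin 2) ℚ →ₐ[ℚ] MvPolynomial (Fin 2) ℚ :=
  MvPolynomial.aeval ![MvPolynomial.X 0 - MvPolynomial.X 1, MvPolynomial.X 0]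

lemma aeval_swapVars {A : Type*} [CommRing A] [Algebra ℚ A] (a b : A)
    (p : MvPolynomial (Fin 2) ℚ) :
    MvPolynomial.aeval ![a, b] (swapVars p) = MvPolynomial.aeval ![b, a] p := by
  rw [swapVars, aeval_aeval_pair]
  simp

lemma aeval_rotVars {A : Type*} [CommRing A] [Algebra ℚ A] (a b : A)
    (p : MvPolynomial (Fin 2) ℚ) :
    MvPolynomial.aeval ![a, b] (rotVars p) = MvPolynomial.aeval ![a - b, a] p := by
  rw [rotVars, aeval_aeval_pair]
  simp

lemma aeval_X_pair (p : MvPolynomial (Fin 2) ℚ) :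
    MvPolynomial.aeval ![MvPolynomial.X 0, MvPolynomial.X 1] p = p := by
  conv_rhs => rw [← MvPolynomial.aeval_X_left_apply p]
  congr 2
  funext i
  fin_cases i <;> rfl

lemma swapVars_swapVars (p : MvPolynomial (Fin 2) ℚ) :
    swapVars (swapVars p) = p := by
  rw [← aeval_X_pair (swapVars _), aeval_swapVars, aeval_swapVars, aeval_X_pair]

lemma aeval_pair_congr_sign {N : ℕ} (P : evenPolys N 2) {A : Type*} [CommRing A] [Algebra ℚ A]
    {a b a' b' : A} (ha : a = a' ∨ a = -a') (hb : b = b' ∨ b = -b') :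
    MvPolynomial.aeval ![a, b] P.1 = MvPolynomial.aeval ![a', b'] P.1 := by
  refine aeval_congr_sign P fun i => ?_
  fin_cases i
  · simpa using ha
  · simpa using hb

lemma periodArg_two (p : ℕ) : periodArg 2 p =
    ![MvPolynomial.X 1 - MvPolynomial.X 0, polyVar 2 p] := by
  funext i
  fin_cases i <;> simp [periodArg, polyVar]

lemma periodDefect_two (p : MvPolynomial (Fin 2) ℚ) : periodDefect 2 p = p -
    (MvPolynomial.aeval ![MvPolynomial.X 1 - MvPolynomial.X 0, MvPolynomial.X 1] p -
      MvPolynomial.aeval ![MvPolynomial.X 1 - MvPolynomial.X 0, MvPolynomial.X 0] p) := by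
  simp [periodDefect, periodArg_two, polyVar]

/-- Before truncation φ_2 is the defect itself, so ker φ_2 = W_{N,2} says that the truncation hides
no nonzero defect. -/
lemma phiPoly_two_two (p : MvPolynomial (Fin 2) ℚ) : phiPoly 2 2 p = periodDefect 2 p := by
  have h : ∀ p, (fun k : Fin 2 => phiArg 2 2 1 p (k.val + 1)) =
      ![MvPolynomial.X 1 - MvPolynomial.X 0, omitVar 2 p 1] := by
    intro p
    funext i
    fin_cases i <;> simp [phiArg, polyVar]
  rw [periodDefect_two]
  simp [phiPoly, h, omitVar, polyVar]
  ring

/-- Setting `y = 0` keeps the coefficients of the powers of `x`. -/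
lemma coeff_aeval_X_zero (p : MvPolynomial (Fin 2) ℚ) {d : Fin 2 →₀ ℕ} (hd : d 1 = 0) :
    MvPolynomial.coeff d (MvPolynomial.aeval
      ![(MvPolynomial.X 0 : MvPolynomial (Fin 2) ℚ), 0] p) = MvPolynomial.coeff d p := by
  classical
  induction p using MvPolynomial.induction_on' with
  | add p q hp hq => rw [map_add, MvPolynomial.coeff_add, MvPolynomial.coeff_add, hp, hq]
  | monomial s c =>
    rw [MvPolynomial.aeval_monomial, Finsupp.prod_fintype _ _ (by simp), Fin.prod_univ_two,
      MvPolynomial.coeff_monomial]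
    by_cases hs : s 1 = 0
    · have : s = Finsupp.single 0 (s 0) := by
        ext i
        fin_cases i <;> simp [hs]
      simp only [Matrix.cons_val_zero, Matrix.cons_val_one, hs, pow_zero, mul_one,
        MvPolynomial.algebraMap_eq, MvPolynomial.C_mul_X_pow_eq_monomial,
        MvPolynomial.coeff_monomial]
      rw [← this]
    · have hne : s ≠ d := by
        rintro rfl
        exact hs hd
      simp [hs, hne]

lemma swapVars_eq_rename (p : MvPolynomial (Fin 2) ℚ) :
    swapVars p = MvPolynomial.rename (Equiv.swap (0 : Fin 2) 1) p := by
  rw [swapVars, MvPolynomial.rename_eq_aeval]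
  congr 2
  funext i
  fin_cases i <;> simp

/-- The exponent vector `(a, b)`. -/
noncomputable def exp2 (a b : ℕ) : Fin 2 →₀ ℕ := Finsupp.equivFunOnFinite.symm ![a, b]

lemma exp2_zero (a b : ℕ) : exp2 a b 0 = a := rfl

lemma exp2_one (a b : ℕ) : exp2 a b 1 = b := rfl

lemma exp2_self (d : Fin 2 →₀ ℕ) : exp2 (d 0) (d 1) = d := by
  ext i
  fin_cases i <;> rfl

lemma coeff_swapVars (p : MvPolynomial (Fin 2) ℚ) (a b : ℕ) :
    MvPolynomial.coeff (exp2 a b) (swapVars p) = MvPolynomial.coeff (exp2 b a) p := by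
  have h : exp2 a b = Finsupp.mapDomain (Equiv.swap (0 : Fin 2) 1) (exp2 b a) := by
    ext i
    rw [Finsupp.mapDomain_equiv_apply]
    fin_cases i <;> simp [exp2]
  rw [swapVars_eq_rename, h, MvPolynomial.coeff_rename_mapDomain _ (Equiv.injective _)]

lemma coeff_aeval_smul_X (p : MvPolynomial (Fin 2) ℚ) (ε δ : ℚ) (d : Fin 2 →₀ ℕ) :
    MvPolynomial.coeff d (MvPolynomial.aeval
      ![ε • (MvPolynomial.X 0 : MvPolynomial (Fin 2) ℚ), δ • MvPolynomial.X 1] p) =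
      ε ^ d 0 * δ ^ d 1 * MvPolynomial.coeff d p := by
  classical
  induction p using MvPolynomial.induction_on' with
  | add p q hp hq =>
    rw [map_add, MvPolynomial.coeff_add, MvPolynomial.coeff_add, hp, hq, mul_add]
  | monomial s c =>
    rw [MvPolynomial.aeval_monomial, Finsupp.prod_fintype _ _ (by simp), Fin.prod_univ_two]
    have h : (algebraMap ℚ (MvPolynomial (Fin 2) ℚ)) c *
        ((![ε • MvPolynomial.X 0, δ • MvPolynomial.X 1] : Fin 2 → MvPolynomial (Fin 2) ℚ) 0 ^ s 0 *
        (![ε • MvPolynomial.X 0, δ • MvPolynomial.X 1] : Fin 2 → MvPolynomial (Fin 2) ℚ) 1 ^ s 1) =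
        MvPolynomial.monomial s (ε ^ s 0 * δ ^ s 1 * c) := by
      rw [MvPolynomial.monomial_eq, Finsupp.prod_fintype _ _ (by simp), Fin.prod_univ_two]
      simp [MvPolynomial.smul_eq_C_mul, mul_pow]
      ring
    rw [h, MvPolynomial.coeff_monomial, MvPolynomial.coeff_monomial]
    split_ifs with hs
    · rw [hs]
    · simp

/-- An antisymmetric polynomial invariant under the rotation is determined by its part that is even
in the first variable. -/
lemma eq_zero_of_odd_of_rotVars {Q : MvPolynomial (Fin 2) ℚ} (hsw : swapVars Q = -Q)
    (hrot : rotVars Q = Q)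
    (hodd : MvPolynomial.aeval ![-MvPolynomial.X 0, MvPolynomial.X 1] Q = -Q) : Q = 0 := by
  have h1 : ∀ a b : ℚ, MvPolynomial.aeval ![b, a] Q = -MvPolynomial.aeval ![a, b] Q := by
    intro a b
    rw [← aeval_swapVars, hsw, map_neg]
  have h2 : ∀ a b : ℚ, MvPolynomial.aeval ![a - b, a] Q = MvPolynomial.aeval ![a, b] Q := by
    intro a b
    rw [← aeval_rotVars, hrot]
  have h3 : ∀ a b : ℚ, MvPolynomial.aeval ![-a, b] Q = -MvPolynomial.aeval ![a, b] Q := by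
    intro a b
    have := congrArg (MvPolynomial.aeval ![a, b]) hodd
    rw [aeval_aeval_pair] at this
    simpa using this
  have h4 : ∀ a b : ℚ, MvPolynomial.aeval ![a, -b] Q = -MvPolynomial.aeval ![a, b] Q := by
    intro a b
    rw [h1, h3, h1 b a]
  have h0 : ∀ a : ℚ, MvPolynomial.aeval ![0, a] Q = 0 := by
    intro a
    have := h3 0 a
    rw [neg_zero] at this
    linarith
  -- Rotation invariance at (-b, a), rewritten by oddness in both variables and antisymmetry,
  -- becomes invariance under (a, b) ↦ (a + b, b). With Q(0, b) = 0 this gives the zeros (kb, b).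
  have hT : ∀ a b : ℚ, MvPolynomial.aeval ![a + b, b] Q = MvPolynomial.aeval ![a, b] Q := by
    intro a b
    have e1 := h2 (-b) a
    rw [show -b - a = -(a + b) by ring, h3, h4, h3, h1 a b] at e1
    linarith
  have hk : ∀ (k : ℕ) (b : ℚ), MvPolynomial.aeval ![k * b, b] Q = 0 := by
    intro k b
    induction k with
    | zero => simpa using h0 b
    | succ k ih =>
      rw [← ih, ← hT (k * b) b]
      push_cast
      rw [add_one_mul]
  refine MvPolynomial.funext fun z => ?_
  rw [map_zero]
  have hz : z = ![z 0, z 1] := by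
    funext i
    fin_cases i <;> rfl
  have hcoe : MvPolynomial.eval z Q = MvPolynomial.aeval ![z 0, z 1] Q := by
    rw [← hz, MvPolynomial.aeval_eq_eval]
  rw [hcoe]
  by_cases hb : z 1 = 0
  · rw [hb, h1, h0, neg_zero]
  -- For `z 1 ≠ 0` the zeros (k · z 1, z 1) are infinitely many roots of one polynomial in one
  -- variable.
  · set g : ℚ[X] := MvPolynomial.aeval ![Polynomial.X, Polynomial.C (z 1)] Q with hg
    have hgeval : ∀ s, g.eval s = MvPolynomial.aeval ![s, z 1] Q := by
      intro s
      rw [hg, ← Polynomial.coe_aeval_eq_eval, ← AlgHom.comp_apply, MvPolynomial.comp_aeval]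
      congr 2
      funext i
      fin_cases i <;> simp
    have hg0 : g = 0 := by
      refine Polynomial.eq_zero_of_infinite_isRoot g ?_
      refine Set.infinite_of_injective_forall_mem (f := fun k : ℕ => (k : ℚ) * z 1) ?_ ?_
      · intro a b hab
        exact_mod_cast mul_right_cancel₀ hb hab
      · intro k
        exact (hgeval _).trans (hk k (z 1))
    rw [← hgeval, hg0, Polynomial.eval_zero]

/-- For an even antisymmetric `P`, the defect of the period relation is the sum over the rotations
of `P`, hence antisymmetric and rotation invariant. -/
lemma periodDefect_two_eq {N : ℕ} (P : evenPolys N 2) (hP : swapVars P.1 = -P.1) :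
    periodDefect 2 P.1 = P.1 + rotVars P.1 + rotVars (rotVars P.1) := by
  have h1 : MvPolynomial.aeval ![MvPolynomial.X 1 - MvPolynomial.X 0, MvPolynomial.X 0] P.1 =
      rotVars P.1 := aeval_pair_congr_sign P (Or.inr (by ring)) (Or.inl rfl)
  have h2 : rotVars (rotVars P.1) =
      -MvPolynomial.aeval ![MvPolynomial.X 1 - MvPolynomial.X 0, MvPolynomial.X 1] P.1 := by
    rw [← map_neg, ← hP, aeval_swapVars]
    have h3 : rotVars (rotVars P.1) = MvPolynomial.aeval
        ![MvPolynomial.X 0 - MvPolynomial.X 1, MvPolynomial.X 0] (rotVars P.1) := rfl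
    rw [h3, aeval_rotVars]
    exact aeval_pair_congr_sign P (Or.inr (by ring)) (Or.inr (by ring))
  rw [periodDefect_two, h1, h2]
  ring

/-- The two substituted terms are exchanged by the swap, because P is even in x_2 - x_1. -/
lemma swapVars_periodDefect_sub {N : ℕ} (P : evenPolys N 2) :
    swapVars (periodDefect 2 P.1 - P.1) = -(periodDefect 2 P.1 - P.1) := by
  have h : ∀ b : MvPolynomial (Fin 2) ℚ,
      MvPolynomial.aeval ![MvPolynomial.X 0 - MvPolynomial.X 1, b] P.1 =
      MvPolynomial.aeval ![MvPolynomial.X 1 - MvPolynomial.X 0, b] P.1 := fun b =>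
    aeval_pair_congr_sign P (Or.inr (by ring)) (Or.inl rfl)
  rw [periodDefect_two, sub_sub_cancel_left, map_neg, map_sub, swapVars, aeval_aeval_pair,
    aeval_aeval_pair]
  simp only [map_sub, MvPolynomial.aeval_X, Matrix.cons_val_zero, Matrix.cons_val_one, h]
  ring

lemma coeff_eq_zero_of_mem_evenPolys {N r : ℕ} (P : evenPolys N r) {d : Fin r →₀ ℕ}
    (hd : ¬∀ i, Even (d i) ∧ 2 ≤ d i) : MvPolynomial.coeff d P.1 = 0 := by
  classical
  rw [evenPolys_eq_sum P]
  simp only [Submodule.coe_sum, Submodule.coe_smul, MvPolynomial.coeff_sum,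
    MvPolynomial.coeff_smul, evenMonomial]
  refine Finset.sum_eq_zero fun m _ => ?_
  rw [MvPolynomial.coeff_monomial, if_neg, smul_zero]
  rintro rfl
  exact hd (shiftedExponent_even m)

lemma swapVars_eq_neg_of_coeff {Q : MvPolynomial (Fin 2) ℚ}
    (h : ∀ a b, MvPolynomial.coeff (exp2 b a) Q = -MvPolynomial.coeff (exp2 a b) Q) :
    swapVars Q = -Q := by
  ext d
  rw [← exp2_self d, coeff_swapVars, MvPolynomial.coeff_neg, h]

lemma coeff_swap_of_swapVars {Q : MvPolynomial (Fin 2) ℚ} (h : swapVars Q = -Q) (a b : ℕ) :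
    MvPolynomial.coeff (exp2 b a) Q = -MvPolynomial.coeff (exp2 a b) Q := by
  rw [← coeff_swapVars, h, MvPolynomial.coeff_neg]

lemma rotVars_rotVars_rotVars_of_even {N : ℕ} (P : evenPolys N 2) :
    rotVars (rotVars (rotVars P.1)) = P.1 := by
  rw [← aeval_X_pair (rotVars _), aeval_rotVars, aeval_rotVars, aeval_rotVars]
  conv_rhs => rw [← aeval_X_pair P.1]
  exact aeval_pair_congr_sign P (Or.inr (by ring)) (Or.inr (by ring))

lemma aeval_neg_neg_eq_of_even {N : ℕ} (P : evenPolys N 2) (hP : swapVars P.1 = -P.1) :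
    MvPolynomial.aeval ![-MvPolynomial.X 0, -MvPolynomial.X 1] (periodDefect 2 P.1) =
      periodDefect 2 P.1 := by
  conv_rhs => rw [← aeval_X_pair (periodDefect 2 P.1)]
  rw [periodDefect_two_eq P hP]
  simp only [map_add]
  rw [aeval_rotVars _ _ (rotVars P.1), aeval_rotVars _ _ (rotVars P.1), aeval_rotVars,
    aeval_rotVars, aeval_rotVars, aeval_rotVars]
  congr 1
  · congr 1
    · exact aeval_pair_congr_sign P (Or.inr rfl) (Or.inr rfl)
    · exact aeval_pair_congr_sign P (Or.inr (by ring)) (Or.inr rfl)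
  · exact aeval_pair_congr_sign P (Or.inr (by ring)) (Or.inr (by ring))

/-- Rotation invariance gives Q(x, 0) = Q(x, x), and antisymmetry kills the diagonal. -/
lemma aeval_X_zero_eq_zero {Q : MvPolynomial (Fin 2) ℚ} (hsw : swapVars Q = -Q)
    (hrot : rotVars Q = Q) :
    MvPolynomial.aeval ![(MvPolynomial.X 0 : MvPolynomial (Fin 2) ℚ), 0] Q = 0 := by
  rw [← hrot, aeval_rotVars, sub_zero]
  have := congrArg (MvPolynomial.aeval
    ![(MvPolynomial.X 0 : MvPolynomial (Fin 2) ℚ), MvPolynomial.X 0]) hsw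
  rw [aeval_swapVars, map_neg] at this
  exact self_eq_neg.1 this

/-- If the truncated defect vanishes, then P is antisymmetric, so the defect Q is antisymmetric and
rotation invariant. Its coefficients on the axes vanish too, so it is odd in x and therefore zero by
`eq_zero_of_odd_of_rotVars`. -/
lemma ker_phi_two (N : ℕ) : LinearMap.ker (phi N 2 2) = periodPolys N 2 := by
  ext P
  rw [LinearMap.mem_ker, mem_periodPolys_iff_periodDefect]
  constructor
  swap
  · intro h
    apply Subtype.ext
    change totallyEvenPart 2 (phiPoly 2 2 P.1) = 0
    rw [phiPoly_two_two, h, map_zero]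
  intro h
  set Q := periodDefect 2 P.1 with hQ
  have hev : ∀ d : Fin 2 →₀ ℕ, (∀ i, Even (d i) ∧ 2 ≤ d i) → MvPolynomial.coeff d Q = 0 := by
    intro d hd
    have h' : totallyEvenPart 2 (phiPoly 2 2 P.1) = 0 := congrArg Subtype.val h
    rw [phiPoly_two_two] at h'
    rw [← coeff_totallyEvenPart _ hd, h', MvPolynomial.coeff_zero]
  have hR := swapVars_periodDefect_sub P
  rw [← hQ] at hR
  -- At admissible exponents Q has coefficient zero, so P has the same coefficients as P - Q, which
  -- is antisymmetric.
  have hP : swapVars P.1 = -P.1 := by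
    refine swapVars_eq_neg_of_coeff fun a b => ?_
    by_cases hab : (Even a ∧ 2 ≤ a) ∧ (Even b ∧ 2 ≤ b)
    · have h1 := coeff_swap_of_swapVars hR a b
      rw [MvPolynomial.coeff_sub, MvPolynomial.coeff_sub, hev, hev] at h1
      · linarith
      · exact Fin.forall_fin_two.2 hab
      · exact Fin.forall_fin_two.2 hab.symm
    · rw [coeff_eq_zero_of_mem_evenPolys, coeff_eq_zero_of_mem_evenPolys, neg_zero]
      · exact fun h => hab (Fin.forall_fin_two.1 h)
      · exact fun h => hab (Fin.forall_fin_two.1 h).symm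
  have hQsw : swapVars Q = -Q := by
    have : Q = (Q - P.1) + P.1 := by ring
    rw [this, map_add, hR, hP]
    ring
  have hQrot : rotVars Q = Q := by
    rw [hQ, periodDefect_two_eq P hP, map_add, map_add, rotVars_rotVars_rotVars_of_even]
    ring
  have hzero : ∀ a, MvPolynomial.coeff (exp2 a 0) Q = 0 := by
    intro a
    rw [← coeff_aeval_X_zero Q (exp2_one a 0), aeval_X_zero_eq_zero hQsw hQrot,
      MvPolynomial.coeff_zero]
  have hpar : ∀ d : Fin 2 →₀ ℕ, Even (d 0) → MvPolynomial.coeff d Q = 0 := by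
    intro d hd0
    by_cases hd1 : Even (d 1)
    · by_cases h0 : d 0 = 0
      · rw [← exp2_self d, coeff_swap_of_swapVars hQsw, h0, hzero, neg_zero]
      · by_cases h1 : d 1 = 0
        · rw [← exp2_self d, h1, hzero]
        · refine hev d (Fin.forall_fin_two.2 ⟨⟨hd0, ?_⟩, ⟨hd1, ?_⟩⟩)
          · obtain ⟨c, hc⟩ := hd0
            omega
          · obtain ⟨c, hc⟩ := hd1
            omega
    -- Exponents of mixed parity are excluded by invariance under (x, y) ↦ (-x, -y).
    · have h1 := coeff_aeval_smul_X Q (-1) (-1) d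
      rw [neg_one_smul, neg_one_smul, aeval_neg_neg_eq_of_even P hP, hd0.neg_one_pow,
        (Nat.not_even_iff_odd.1 hd1).neg_one_pow, ← hQ] at h1
      linarith
  refine eq_zero_of_odd_of_rotVars hQsw hQrot ?_
  ext d
  have h1 := coeff_aeval_smul_X Q (-1) 1 d
  rw [neg_one_smul, one_smul] at h1
  rw [h1, MvPolynomial.coeff_neg]
  rcases Nat.even_or_odd (d 0) with hd | hd
  · rw [hpar d hd]
    simp
  · rw [hd.neg_one_pow]
    simp

/-! ### The rotation sum maps onto the antisymmetric invariants. -/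

lemma isHomogeneous_of_mem_evenPolys {N r : ℕ} (P : evenPolys N r) :
    P.1.IsHomogeneous (N - r) := by
  have h : evenPolys N r ≤ MvPolynomial.homogeneousSubmodule (Fin r) ℚ (N - r) := by
    refine Submodule.span_le.2 ?_
    rintro _ ⟨m, rfl⟩
    refine MvPolynomial.isHomogeneous_monomial _ ?_
    obtain ⟨h1, h2⟩ := mem_oddIndices.1 m.2
    rw [Finsupp.degree_eq_sum]
    have : ∀ i, m.1 i = shiftedExponent m.1 i + 1 := fun i => by
      have := (h2 i).1
      simp only [shiftedExponent, Finsupp.equivFunOnFinite_symm_apply_apply]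
      omega
    rw [Finset.sum_congr rfl fun i _ => this i, Finset.sum_add_distrib] at h1
    simp at h1
    omega
  exact h P.2

lemma X_pow_mul_X_pow (a b : ℕ) : (MvPolynomial.X 0 : MvPolynomial (Fin 2) ℚ) ^ a *
    MvPolynomial.X 1 ^ b = MvPolynomial.monomial (exp2 a b) 1 := by
  rw [exp2, ← prod_X_pow_eq_monomial, Fin.prod_univ_two]
  rfl

lemma coeff_X_pow_mul_X_pow (a b c d : ℕ) : MvPolynomial.coeff (exp2 c d)
    ((MvPolynomial.X 0 : MvPolynomial (Fin 2) ℚ) ^ a * MvPolynomial.X 1 ^ b) =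
      if a = c ∧ b = d then 1 else 0 := by
  classical
  rw [X_pow_mul_X_pow, MvPolynomial.coeff_monomial]
  refine if_congr ⟨fun h => ?_, fun h => by rw [h.1, h.2]⟩ rfl rfl
  exact ⟨DFunLike.congr_fun h 0, DFunLike.congr_fun h 1⟩

/-- A linear map vanishing on the monomials of degree `n` vanishes on homogeneous polynomials of
degree `n`. -/
lemma map_eq_zero_of_isHomogeneous {V : Type*} [AddCommGroup V] [Module ℚ V] {n : ℕ}
    (g : MvPolynomial (Fin 2) ℚ →ₗ[ℚ] V)
    (h : ∀ a b, a + b = n → g (MvPolynomial.X 0 ^ a * MvPolynomial.X 1 ^ b) = 0)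
    {p : MvPolynomial (Fin 2) ℚ} (hp : p.IsHomogeneous n) : g p = 0 := by
  rw [p.as_sum, map_sum]
  refine Finset.sum_eq_zero fun d hd => ?_
  have hdeg : d 0 + d 1 = n := by
    by_contra hne
    refine (MvPolynomial.mem_support_iff.1 hd) (hp.coeff_eq_zero ?_)
    rwa [Finsupp.degree_eq_sum, Fin.sum_univ_two]
  have : MvPolynomial.monomial d (MvPolynomial.coeff d p) = MvPolynomial.coeff d p •
      ((MvPolynomial.X 0 : MvPolynomial (Fin 2) ℚ) ^ d 0 * MvPolynomial.X 1 ^ d 1) := by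
    rw [X_pow_mul_X_pow, exp2_self, MvPolynomial.smul_monomial, smul_eq_mul, mul_one]
  rw [this, map_smul, h _ _ hdeg, smul_zero]

lemma aeval_neg_neg_of_isHomogeneous {n : ℕ} (hn : Even n) {p : MvPolynomial (Fin 2) ℚ}
    (hp : p.IsHomogeneous n) {A : Type*} [CommRing A] [Algebra ℚ A] (a b : A) :
    MvPolynomial.aeval ![-a, -b] p = MvPolynomial.aeval ![a, b] p := by
  rw [← sub_eq_zero]
  refine map_eq_zero_of_isHomogeneous ((MvPolynomial.aeval ![-a, -b]).toLinearMap -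
    (MvPolynomial.aeval ![a, b]).toLinearMap) (fun i j hij => ?_) hp
  simp only [LinearMap.sub_apply, AlgHom.toLinearMap_apply, map_mul, map_pow,
    MvPolynomial.aeval_X, Matrix.cons_val_zero, Matrix.cons_val_one]
  rw [neg_pow a, neg_pow b]
  have : (-1 : A) ^ i * (-1) ^ j = 1 := by rw [← pow_add, hij, hn.neg_one_pow]
  linear_combination (a ^ i * b ^ j) * this

lemma isHomogeneous_swapVars {n : ℕ} {p : MvPolynomial (Fin 2) ℚ} (hp : p.IsHomogeneous n) :
    (swapVars p).IsHomogeneous n := by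
  have := hp.aeval (n := 1) (![MvPolynomial.X 1, MvPolynomial.X 0] : Fin 2 → MvPolynomial (Fin 2) ℚ)
    (Fin.forall_fin_two.2 ⟨MvPolynomial.isHomogeneous_X _ _, MvPolynomial.isHomogeneous_X _ _⟩)
  rwa [one_mul] at this

lemma isHomogeneous_rotVars {n : ℕ} {p : MvPolynomial (Fin 2) ℚ} (hp : p.IsHomogeneous n) :
    (rotVars p).IsHomogeneous n := by
  have := hp.aeval (n := 1)
    (![MvPolynomial.X 0 - MvPolynomial.X 1, MvPolynomial.X 0] : Fin 2 → MvPolynomial (Fin 2) ℚ)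
    (Fin.forall_fin_two.2 ⟨(MvPolynomial.isHomogeneous_X _ _).sub
      (MvPolynomial.isHomogeneous_X _ _), MvPolynomial.isHomogeneous_X _ _⟩)
  rwa [one_mul] at this

lemma rotVars_rotVars_rotVars {n : ℕ} (hn : Even n) {p : MvPolynomial (Fin 2) ℚ}
    (hp : p.IsHomogeneous n) : rotVars (rotVars (rotVars p)) = p := by
  rw [← aeval_X_pair (rotVars _), aeval_rotVars, aeval_rotVars, aeval_rotVars]
  conv_rhs => rw [← aeval_X_pair p]
  rw [← aeval_neg_neg_of_isHomogeneous hn hp]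
  congr 3 <;> ring_nf

/-- The dihedral relation holds up to (x, y) ↦ (-x, -y), which is trivial in even degree; so swap
and rotation generate an action of S_3. -/
lemma swapVars_rotVars {n : ℕ} (hn : Even n) {p : MvPolynomial (Fin 2) ℚ}
    (hp : p.IsHomogeneous n) : swapVars (rotVars p) = rotVars (rotVars (swapVars p)) := by
  rw [← aeval_X_pair (swapVars _), ← aeval_X_pair (rotVars (rotVars _)), aeval_swapVars,
    aeval_rotVars, aeval_rotVars, aeval_rotVars, aeval_swapVars]
  rw [← aeval_neg_neg_of_isHomogeneous hn hp]
  congr 3 <;> ring_nf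

/-- The sum over the rotations `1 + U + U²`. -/
noncomputable def rotSum : MvPolynomial (Fin 2) ℚ →ₗ[ℚ] MvPolynomial (Fin 2) ℚ :=
  LinearMap.id + rotVars.toLinearMap + rotVars.toLinearMap ∘ₗ rotVars.toLinearMap

lemma rotSum_apply (p : MvPolynomial (Fin 2) ℚ) :
    rotSum p = p + rotVars p + rotVars (rotVars p) := rfl

/-- The antisymmetric polynomials in `V_{N,2}`. -/
noncomputable def antisymmPolys (N : ℕ) : Submodule ℚ (evenPolys N 2) :=
  LinearMap.ker ((swapVars.toLinearMap + LinearMap.id) ∘ₗ (evenPolys N 2).subtype)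

lemma mem_antisymmPolys {N : ℕ} {P : evenPolys N 2} :
    P ∈ antisymmPolys N ↔ swapVars P.1 = -P.1 := by
  simp [antisymmPolys, LinearMap.mem_ker, add_eq_zero_iff_eq_neg]

/-- The homogeneous antisymmetric rotation invariant polynomials in two variables. -/
noncomputable def invPolys (n : ℕ) : Submodule ℚ (MvPolynomial (Fin 2) ℚ) :=
  MvPolynomial.homogeneousSubmodule (Fin 2) ℚ n ⊓
    (LinearMap.ker (swapVars.toLinearMap + LinearMap.id) ⊓
      LinearMap.ker (rotVars.toLinearMap - LinearMap.id))

lemma mem_invPolys {n : ℕ} {Q : MvPolynomial (Fin 2) ℚ} :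
    Q ∈ invPolys n ↔ Q.IsHomogeneous n ∧ swapVars Q = -Q ∧ rotVars Q = Q := by
  simp [invPolys, LinearMap.mem_ker, add_eq_zero_iff_eq_neg, sub_eq_zero]

lemma X_pow_mul_X_pow_mem_evenPolys {N a b : ℕ} (ha : Even a) (ha2 : 2 ≤ a) (hb : Even b)
    (hb2 : 2 ≤ b) (hN : a + b + 2 = N) :
    (MvPolynomial.X 0 : MvPolynomial (Fin 2) ℚ) ^ a * MvPolynomial.X 1 ^ b ∈ evenPolys N 2 := by
  rw [X_pow_mul_X_pow]
  have hm : ![a + 1, b + 1] ∈ oddIndices N 2 := by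
    refine mem_oddIndices.2 ⟨?_, Fin.forall_fin_two.2 ⟨⟨?_, ?_⟩, ⟨?_, ?_⟩⟩⟩
    · simp
      omega
    · simp
      omega
    · simpa using ha.add_one
    · simp
      omega
    · simpa using hb.add_one
  have he : shiftedExponent ![a + 1, b + 1] = exp2 a b := by
    ext i
    fin_cases i <;> simp [shiftedExponent, exp2]
  rw [← he]
  exact Submodule.subset_span ⟨⟨_, hm⟩, rfl⟩

lemma rotSum_mem_invPolys {n : ℕ} (hn : Even n) {p : MvPolynomial (Fin 2) ℚ}
    (hp : p.IsHomogeneous n) (hsw : swapVars p = -p) : rotSum p ∈ invPolys n := by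
  have h1 := isHomogeneous_rotVars hp
  refine mem_invPolys.2 ⟨(hp.add h1).add (isHomogeneous_rotVars h1), ?_, ?_⟩
  · rw [rotSum_apply, map_add, map_add, swapVars_rotVars hn h1, swapVars_rotVars hn hp, hsw,
      map_neg, map_neg, map_neg, map_neg, rotVars_rotVars_rotVars hn hp]
    ring
  · rw [rotSum_apply, map_add, map_add, rotVars_rotVars_rotVars hn hp]
    ring

/-- A functional on homogeneous polynomials of even degree vanishing on the even ones, antisymmetric
and rotation invariant, vanishes. -/
lemma functional_eq_zero {n : ℕ} (hn : Even n) (μ : MvPolynomial (Fin 2) ℚ →ₗ[ℚ] ℚ)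
    (hev : ∀ a b, a + b = n → Even a → μ (MvPolynomial.X 0 ^ a * MvPolynomial.X 1 ^ b) = 0)
    (hsw : ∀ p, μ (swapVars p) = -μ p)
    (hrot : ∀ p : MvPolynomial (Fin 2) ℚ, p.IsHomogeneous n → μ (rotVars p) = μ p)
    {p : MvPolynomial (Fin 2) ℚ} (hp : p.IsHomogeneous n) : μ p = 0 := by
  have hneg : ∀ p : MvPolynomial (Fin 2) ℚ, p.IsHomogeneous n →
      μ (MvPolynomial.aeval ![-MvPolynomial.X 0, MvPolynomial.X 1] p) = -μ p := by
    intro p hp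
    rw [← add_eq_zero_iff_eq_neg]
    refine map_eq_zero_of_isHomogeneous (μ ∘ₗ (MvPolynomial.aeval
      ![-(MvPolynomial.X 0 : MvPolynomial (Fin 2) ℚ), MvPolynomial.X 1]).toLinearMap + μ)
      (fun a b hab => ?_) hp
    simp only [LinearMap.add_apply, LinearMap.comp_apply, AlgHom.toLinearMap_apply, map_mul,
      map_pow, MvPolynomial.aeval_X, Matrix.cons_val_zero, Matrix.cons_val_one]
    rcases Nat.even_or_odd a with ha | ha
    · rw [ha.neg_pow, hev a b hab ha, add_zero]
    · rw [ha.neg_pow, neg_mul, map_neg, neg_add_cancel]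
  -- The composite of the rotation, the swap and x ↦ -x is the shear x ↦ x + y, and the two signs
  -- cancel.
  have htrans : ∀ p : MvPolynomial (Fin 2) ℚ, p.IsHomogeneous n →
      μ (MvPolynomial.aeval ![MvPolynomial.X 0 + MvPolynomial.X 1, MvPolynomial.X 1] p) = μ p := by
    intro p hp
    have h := hneg _ (isHomogeneous_swapVars (isHomogeneous_rotVars hp))
    rw [hsw, hrot p hp, neg_neg, aeval_swapVars, aeval_rotVars] at h
    rw [← h, sub_neg_eq_add, add_comm]
  refine map_eq_zero_of_isHomogeneous μ (fun a b hab => ?_) hp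
  induction a using Nat.strong_induction_on generalizing b with
  | _ a ih =>
    rcases Nat.even_or_odd a with ha | ha
    · exact hev a b hab ha
    · have hb : 1 ≤ b := by
        rcases Nat.eq_zero_or_pos b with rfl | hb
        · rw [← hab, add_zero] at hn
          exact absurd hn (Nat.not_even_iff_odd.2 ha)
        · exact hb
      obtain ⟨c, rfl⟩ := Nat.exists_eq_add_of_le' hb
      have hhom : ((MvPolynomial.X 0 : MvPolynomial (Fin 2) ℚ) ^ (a + 1) *
          MvPolynomial.X 1 ^ c).IsHomogeneous n := by
        rw [← hab, show a + (c + 1) = (a + 1) + c by omega]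
        exact (MvPolynomial.isHomogeneous_X_pow _ _).mul (MvPolynomial.isHomogeneous_X_pow _ _)
      -- Expand (x + y)^{a+1} y^c: the top term cancels, the terms with k < a vanish by induction,
      -- and (a + 1) μ(x^a y^{c+1}) = 0 remains.
      have h := htrans _ hhom
      simp only [map_mul, map_pow, MvPolynomial.aeval_X, Matrix.cons_val_zero,
        Matrix.cons_val_one] at h
      rw [add_pow, Finset.sum_mul, Finset.sum_range_succ, map_add, Finset.sum_range_succ, map_add,
        map_sum] at h
      have hterm : ∀ k ≤ a, μ (MvPolynomial.X 0 ^ k * MvPolynomial.X 1 ^ (a + 1 - k) *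
          ((a + 1).choose k : MvPolynomial (Fin 2) ℚ) * MvPolynomial.X 1 ^ c) =
          ((a + 1).choose k : ℚ) *
            μ (MvPolynomial.X 0 ^ k * MvPolynomial.X 1 ^ (a - k + (c + 1))) := by
        intro k hk
        rw [← smul_eq_mul (a := ((a + 1).choose k : ℚ)), ← map_smul]
        congr 1
        rw [MvPolynomial.smul_eq_C_mul, map_natCast,
          show a - k + (c + 1) = (a + 1 - k) + c by omega, pow_add]
        ring
      rw [hterm a le_rfl, Finset.sum_eq_zero] at h
      · simp only [Nat.sub_self, pow_zero, mul_one, Nat.choose_self, Nat.cast_one, zero_add,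
          Nat.choose_succ_self_right] at h
        have h2 : ((a + 1 : ℕ) : ℚ) ≠ 0 := by positivity
        refine (mul_eq_zero.1 ?_).resolve_left h2
        linarith
      · intro k hk
        have hk := Finset.mem_range.1 hk
        rw [hterm k hk.le, ih k hk _ (by omega), mul_zero]

/-- By duality: a functional f that kills the image but not Q would give μ = f ∘ (1 + U + U²) ∘ (1 -
swap), which satisfies the hypotheses of `functional_eq_zero` although μ(Q) = 6 f(Q). -/
lemma exists_rotSum_eq {N : ℕ} (hN : Even N) (hN2 : 4 ≤ N) {Q : MvPolynomial (Fin 2) ℚ}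
    (hQ : Q ∈ invPolys (N - 2)) : ∃ P ∈ antisymmPolys N, rotSum P.1 = Q := by
  have hn : Even (N - 2) := (Nat.even_sub (by omega)).2 (by simp [hN])
  by_contra hcon
  have hnot : Q ∉ (antisymmPolys N).map (rotSum ∘ₗ (evenPolys N 2).subtype) := by
    rintro ⟨P, hP, h⟩
    exact hcon ⟨P, hP, h⟩
  obtain ⟨f, hfQ, hf⟩ := Submodule.exists_le_ker_of_notMem hnot
  obtain ⟨hhom, hsw, hrot⟩ := mem_invPolys.1 hQ
  let μ : MvPolynomial (Fin 2) ℚ →ₗ[ℚ] ℚ :=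
    f ∘ₗ rotSum ∘ₗ (LinearMap.id - swapVars.toLinearMap)
  have hμ : ∀ p, μ p = f (rotSum (p - swapVars p)) := fun p => rfl
  have hzero : μ Q = 0 := by
    refine functional_eq_zero hn μ ?_ ?_ ?_ hhom
    · intro a b hab ha
      have hb : Even b := (Nat.even_add.1 (hab ▸ hn)).1 ha
      rw [hμ]
      -- Pure powers lie outside V_{N,2}, but the rotation sum of y^n - x^n telescopes to y^n -
      -- (-y)^n = 0 for even n.
      by_cases ha0 : a = 0
      · subst ha0
        obtain rfl : b = N - 2 := by omega
        simp only [rotSum_apply, swapVars, rotVars, pow_zero, one_mul, map_sub, map_pow,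
          MvPolynomial.aeval_X, Matrix.cons_val_zero, Matrix.cons_val_one]
        rw [sub_sub_cancel_left, hn.neg_pow]
        ring_nf
      · by_cases hb0 : b = 0
        · subst hb0
          obtain rfl : a = N - 2 := by omega
          simp only [rotSum_apply, swapVars, rotVars, pow_zero, mul_one, map_sub, map_pow,
            MvPolynomial.aeval_X, Matrix.cons_val_zero, Matrix.cons_val_one]
          rw [sub_sub_cancel_left, hn.neg_pow]
          ring_nf
        · have ha2 : 2 ≤ a := by
            obtain ⟨c, hc⟩ := ha
            omega
          have hb2 : 2 ≤ b := by
            obtain ⟨c, hc⟩ := hb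
            omega
          have hswap : swapVars ((MvPolynomial.X 0 : MvPolynomial (Fin 2) ℚ) ^ a *
              MvPolynomial.X 1 ^ b) = MvPolynomial.X 0 ^ b * MvPolynomial.X 1 ^ a := by
            simp [swapVars, mul_comm]
          refine hf ⟨⟨_, Submodule.sub_mem _
            (X_pow_mul_X_pow_mem_evenPolys (N := N) ha ha2 hb hb2 (by omega))
            (X_pow_mul_X_pow_mem_evenPolys (N := N) hb hb2 ha ha2 (by omega))⟩, ?_, ?_⟩
          · rw [SetLike.mem_coe, mem_antisymmPolys]
            simp [swapVars, mul_comm]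
          · rw [hswap]
            rfl
    · intro p
      rw [hμ, hμ, swapVars_swapVars, ← map_neg, ← map_neg, neg_sub]
    · intro p hp
      have hinv : ∀ q : MvPolynomial (Fin 2) ℚ, q.IsHomogeneous (N - 2) →
          rotSum (rotVars q) = rotSum q := by
        intro q hq
        rw [rotSum_apply, rotSum_apply, rotVars_rotVars_rotVars hn hq]
        ring
      have hps := isHomogeneous_swapVars hp
      rw [hμ, hμ, map_sub, map_sub rotSum p, hinv p hp, swapVars_rotVars hn hp,
        hinv _ (isHomogeneous_rotVars hps), hinv _ hps]
  rw [hμ, hsw, rotSum_apply] at hzero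
  simp only [map_sub, map_neg, hrot, map_add] at hzero
  exact hfQ (by linarith)

/-! ### Counting the antisymmetric invariants. -/

/-- The invariant `x² y² (x - y)²`. -/
noncomputable def sqInv : MvPolynomial (Fin 2) ℚ :=
  MvPolynomial.X 1 ^ 2 * (MvPolynomial.X 0 ^ 2 * (MvPolynomial.X 0 - MvPolynomial.X 1) ^ 2)

/-- The invariant `x² - x y + y²`. -/
noncomputable def quadInv : MvPolynomial (Fin 2) ℚ :=
  MvPolynomial.X 0 ^ 2 - MvPolynomial.X 0 * MvPolynomial.X 1 + MvPolynomial.X 1 ^ 2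

/-- The antisymmetric invariant `x y (x - y) (x - 2y) (2x - y) (x + y)`. -/
noncomputable def altInv : MvPolynomial (Fin 2) ℚ :=
  MvPolynomial.X 1 * (MvPolynomial.X 0 * (MvPolynomial.X 0 - MvPolynomial.X 1) *
    (MvPolynomial.X 0 - 2 * MvPolynomial.X 1) * (2 * MvPolynomial.X 0 - MvPolynomial.X 1) *
    (MvPolynomial.X 0 + MvPolynomial.X 1))

lemma swapVars_sqInv : swapVars sqInv = sqInv := by
  simp only [swapVars, sqInv, map_mul, map_pow, map_sub, MvPolynomial.aeval_X,
    Matrix.cons_val_zero, Matrix.cons_val_one]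
  ring

lemma rotVars_sqInv : rotVars sqInv = sqInv := by
  simp only [rotVars, sqInv, map_mul, map_pow, map_sub, MvPolynomial.aeval_X,
    Matrix.cons_val_zero, Matrix.cons_val_one]
  ring

lemma swapVars_quadInv : swapVars quadInv = quadInv := by
  simp only [swapVars, quadInv, map_mul, map_pow, map_sub, map_add, MvPolynomial.aeval_X,
    Matrix.cons_val_zero, Matrix.cons_val_one]
  ring

lemma rotVars_quadInv : rotVars quadInv = quadInv := by
  simp only [rotVars, quadInv, map_mul, map_pow, map_sub, map_add, MvPolynomial.aeval_X,
    Matrix.cons_val_zero, Matrix.cons_val_one]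
  ring

lemma swapVars_altInv : swapVars altInv = -altInv := by
  simp only [swapVars, altInv, map_mul, map_sub, map_add, MvPolynomial.aeval_X,
    Matrix.cons_val_zero, Matrix.cons_val_one, map_ofNat]
  ring

lemma rotVars_altInv : rotVars altInv = altInv := by
  simp only [rotVars, altInv, map_mul, map_sub, map_add, MvPolynomial.aeval_X,
    Matrix.cons_val_zero, Matrix.cons_val_one, map_ofNat]
  ring

lemma isHomogeneous_X_sub : (MvPolynomial.X 0 - MvPolynomial.X 1 :
    MvPolynomial (Fin 2) ℚ).IsHomogeneous 1 :=
  (MvPolynomial.isHomogeneous_X _ _).sub (MvPolynomial.isHomogeneous_X _ _)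

lemma isHomogeneous_sqInv : sqInv.IsHomogeneous 6 :=
  (MvPolynomial.isHomogeneous_X_pow _ _).mul
    ((MvPolynomial.isHomogeneous_X_pow _ _).mul (isHomogeneous_X_sub.pow 2))

lemma isHomogeneous_quadInv : quadInv.IsHomogeneous 2 :=
  ((MvPolynomial.isHomogeneous_X_pow _ _).sub
    ((MvPolynomial.isHomogeneous_X _ _).mul (MvPolynomial.isHomogeneous_X _ _))).add
    (MvPolynomial.isHomogeneous_X_pow _ _)

lemma isHomogeneous_altInv : altInv.IsHomogeneous 6 := by
  have h2 : (2 : MvPolynomial (Fin 2) ℚ) = MvPolynomial.C 2 :=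
    (map_ofNat MvPolynomial.C 2).symm
  have hX : ∀ i, (2 * MvPolynomial.X i : MvPolynomial (Fin 2) ℚ).IsHomogeneous 1 := fun i => by
    rw [h2]
    exact (MvPolynomial.isHomogeneous_X _ _).C_mul 2
  exact (MvPolynomial.isHomogeneous_X _ _).mul
    (((((MvPolynomial.isHomogeneous_X _ _).mul isHomogeneous_X_sub).mul
      ((MvPolynomial.isHomogeneous_X _ _).sub (hX 1))).mul
      ((hX 0).sub (MvPolynomial.isHomogeneous_X _ _))).mul
      ((MvPolynomial.isHomogeneous_X _ _).add (MvPolynomial.isHomogeneous_X _ _)))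

lemma not_X_one_dvd_of_aeval {p : MvPolynomial (Fin 2) ℚ}
    (h : MvPolynomial.aeval ![(1 : ℚ), 0] p ≠ 0) : ¬(MvPolynomial.X 1 ∣ p) := by
  rintro ⟨q, rfl⟩
  simp at h

lemma not_X_zero_dvd_of_aeval {p : MvPolynomial (Fin 2) ℚ}
    (h : MvPolynomial.aeval ![(0 : ℚ), 1] p ≠ 0) : ¬(MvPolynomial.X 0 ∣ p) := by
  rintro ⟨q, rfl⟩
  simp at h

lemma sqInv_ne_zero : sqInv ≠ 0 := by
  intro h
  have := congrArg (MvPolynomial.aeval ![(2 : ℚ), 1]) h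
  norm_num [sqInv] at this

lemma X_one_sq_dvd {Q : MvPolynomial (Fin 2) ℚ} (h0 : ∀ a, MvPolynomial.coeff (exp2 a 0) Q = 0)
    (h1 : ∀ a, MvPolynomial.coeff (exp2 a 1) Q = 0) : MvPolynomial.X 1 ^ 2 ∣ Q := by
  rw [Q.as_sum]
  refine Finset.dvd_sum fun d hd => ?_
  have hd2 : 2 ≤ d 1 := by
    by_contra hlt
    refine MvPolynomial.mem_support_iff.1 hd ?_
    rcases (by omega : d 1 = 0 ∨ d 1 = 1) with h | h
    · rw [← exp2_self d, h, h0]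
    · rw [← exp2_self d, h, h1]
  refine ⟨MvPolynomial.C (MvPolynomial.coeff d Q) *
    (MvPolynomial.X 0 ^ d 0 * MvPolynomial.X 1 ^ (d 1 - 2)), ?_⟩
  have h := X_pow_mul_X_pow (d 0) (d 1)
  rw [exp2_self] at h
  rw [← mul_one (MvPolynomial.coeff d Q), ← MvPolynomial.C_mul_monomial, ← h, mul_one]
  conv_lhs => rw [← Nat.sub_add_cancel hd2, pow_add]
  ring

/-- An antisymmetric rotation invariant polynomial vanishing to second order along `y = 0` is
divisible by `x² y² (x - y)²`. -/
lemma sqInv_dvd {Q : MvPolynomial (Fin 2) ℚ} (hsw : swapVars Q = -Q) (hrot : rotVars Q = Q)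
    (h1 : ∀ a, MvPolynomial.coeff (exp2 a 1) Q = 0) : sqInv ∣ Q := by
  have h0 : ∀ a, MvPolynomial.coeff (exp2 a 0) Q = 0 := fun a => by
    rw [← coeff_aeval_X_zero Q (exp2_one a 0), aeval_X_zero_eq_zero hsw hrot,
      MvPolynomial.coeff_zero]
  obtain ⟨R₁, hR₁⟩ := X_one_sq_dvd h0 h1
  have hX0 : (MvPolynomial.X 0 : MvPolynomial (Fin 2) ℚ) ^ 2 ∣ MvPolynomial.X 1 ^ 2 * R₁ := by
    refine ⟨-swapVars R₁, ?_⟩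
    rw [← hR₁, ← neg_eq_iff_eq_neg.2 hsw, hR₁]
    simp [swapVars]
  have hp0 : Prime (MvPolynomial.X 0 : MvPolynomial (Fin 2) ℚ) := MvPolynomial.X_prime
  have hp1 : Prime (MvPolynomial.X 1 : MvPolynomial (Fin 2) ℚ) := MvPolynomial.X_prime
  obtain ⟨R₂, rfl⟩ := hp0.pow_dvd_of_dvd_mul_left 2 (not_X_zero_dvd_of_aeval (by simp)) hX0
  -- With Q = x²y²R₂, rotation invariance reads (x - y)² U(R₂) = y² R₂. Hence y² divides U(R₂), and
  -- cancelling y² shows that (x - y)² divides R₂.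
  have hrot2 : MvPolynomial.X 0 ^ 2 * ((MvPolynomial.X 0 - MvPolynomial.X 1) ^ 2 * rotVars R₂) =
      MvPolynomial.X 0 ^ 2 * (MvPolynomial.X 1 ^ 2 * R₂) := by
    calc MvPolynomial.X 0 ^ 2 * ((MvPolynomial.X 0 - MvPolynomial.X 1) ^ 2 * rotVars R₂)
        = rotVars Q := by rw [hR₁]; simp [rotVars]
      _ = _ := by rw [hrot, hR₁]; ring
  have hrot3 := mul_left_cancel₀ (pow_ne_zero 2 hp0.ne_zero) hrot2
  obtain ⟨R₃, hR₃⟩ := hp1.pow_dvd_of_dvd_mul_left 2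
    (not_X_one_dvd_of_aeval (by simp)) (Dvd.intro _ hrot3.symm)
  rw [hR₃, mul_left_comm] at hrot3
  have hR₂ := mul_left_cancel₀ (pow_ne_zero 2 hp1.ne_zero) hrot3
  refine ⟨R₃, ?_⟩
  rw [hR₁, ← hR₂, sqInv]
  ring

attribute [local instance] MvPolynomial.gradedAlgebra in
lemma homogeneousComponent_mul_of_isHomogeneous {σ : Type*} {p q : MvPolynomial σ ℚ} {m : ℕ}
    (hp : p.IsHomogeneous m) (k : ℕ) :
    MvPolynomial.homogeneousComponent (m + k) (p * q) =
      p * MvPolynomial.homogeneousComponent k q := by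
  have h := DirectSum.coe_decompose_mul_add_of_left_mem (MvPolynomial.homogeneousSubmodule σ ℚ)
    (i := m) (j := k) (a := p) (b := q) hp
  have h2 : ∀ (r : MvPolynomial σ ℚ) (i : ℕ),
      (DirectSum.decompose (MvPolynomial.homogeneousSubmodule σ ℚ) r i : MvPolynomial σ ℚ) =
      MvPolynomial.homogeneousComponent i r := fun r i =>
    MvPolynomial.decomposition.decompose'_apply r i
  rwa [h2, h2] at h

lemma mul_sqInv_mem_invPolys_iff {n : ℕ} {R : MvPolynomial (Fin 2) ℚ} :
    sqInv * R ∈ invPolys (6 + n) ↔ R ∈ invPolys n := by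
  rw [mem_invPolys, mem_invPolys, map_mul, map_mul, swapVars_sqInv, rotVars_sqInv, ← mul_neg,
    mul_right_inj' sqInv_ne_zero, mul_right_inj' sqInv_ne_zero]
  refine and_congr_left fun _ => ⟨fun h => ?_, fun h => isHomogeneous_sqInv.mul h⟩
  have h1 := homogeneousComponent_mul_of_isHomogeneous isHomogeneous_sqInv n (q := R)
  rw [MvPolynomial.homogeneousComponent_eq_self h] at h1
  rw [mul_left_cancel₀ sqInv_ne_zero h1]
  exact MvPolynomial.homogeneousComponent_isHomogeneous _ _

/-- The coefficient of `y` after setting `x = 1`. -/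
noncomputable def linCoeff : MvPolynomial (Fin 2) ℚ →ₗ[ℚ] ℚ :=
  Polynomial.lcoeff ℚ 1 ∘ₗ (MvPolynomial.aeval ![(1 : ℚ[X]), Polynomial.X]).toLinearMap

lemma linCoeff_apply (p : MvPolynomial (Fin 2) ℚ) :
    linCoeff p = (MvPolynomial.aeval ![(1 : ℚ[X]), Polynomial.X] p).coeff 1 := rfl

lemma linCoeff_eq_coeff {n : ℕ} {p : MvPolynomial (Fin 2) ℚ} (hp : p.IsHomogeneous (n + 1)) :
    linCoeff p = MvPolynomial.coeff (exp2 n 1) p := by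
  rw [← sub_eq_zero]
  refine map_eq_zero_of_isHomogeneous (linCoeff - MvPolynomial.lcoeff ℚ (exp2 n 1))
    (fun a b hab => ?_) hp
  rw [LinearMap.sub_apply, linCoeff_apply, MvPolynomial.lcoeff_apply, coeff_X_pow_mul_X_pow]
  simp only [map_mul, map_pow, MvPolynomial.aeval_X, Matrix.cons_val_zero, Matrix.cons_val_one,
    one_pow, one_mul, Polynomial.coeff_X_pow]
  rw [sub_eq_zero]
  exact if_congr ⟨fun h => ⟨by omega, h.symm⟩, fun h => h.2.symm⟩ rfl rfl

lemma linCoeff_sqInv_mul (R : MvPolynomial (Fin 2) ℚ) : linCoeff (sqInv * R) = 0 := by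
  rw [linCoeff_apply, sqInv, mul_assoc, map_mul, map_pow, MvPolynomial.aeval_X]
  simp [Polynomial.coeff_X_pow_mul']

/-- At x = 1 the polynomial `altInv` is y times a factor with constant term 2, while `quadInv` has
constant term 1. -/
lemma linCoeff_altInv_mul (k : ℕ) : linCoeff (altInv * quadInv ^ k) = 2 := by
  rw [linCoeff_apply, altInv, mul_assoc, map_mul, MvPolynomial.aeval_X]
  simp only [Matrix.cons_val_one, Matrix.cons_val_fin_one]
  rw [Polynomial.coeff_X_mul, Polynomial.coeff_zero_eq_eval_zero]
  simp [quadInv]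

lemma altInv_mul_mem_invPolys (k : ℕ) : altInv * quadInv ^ k ∈ invPolys (6 + 2 * k) := by
  refine mem_invPolys.2 ⟨isHomogeneous_altInv.mul (isHomogeneous_quadInv.pow k), ?_, ?_⟩
  · rw [map_mul, map_pow, swapVars_altInv, swapVars_quadInv, neg_mul]
  · rw [map_mul, map_pow, rotVars_altInv, rotVars_quadInv]

/-- By homogeneity x^{n-1} y is the only monomial of exponent one in y, so one number decides
vanishing to second order along y = 0. -/
lemma sqInv_dvd_of_linCoeff {n : ℕ} {Q : MvPolynomial (Fin 2) ℚ} (hQ : Q ∈ invPolys n)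
    (h : linCoeff Q = 0) : sqInv ∣ Q := by
  obtain ⟨hhom, hsw, hrot⟩ := mem_invPolys.1 hQ
  refine sqInv_dvd hsw hrot fun a => ?_
  by_cases ha : a + 1 = n
  · subst ha
    rw [← linCoeff_eq_coeff hhom, h]
  · refine hhom.coeff_eq_zero ?_
    rw [Finsupp.degree_eq_sum, Fin.sum_univ_two]
    exact ha

instance (n : ℕ) : FiniteDimensional ℚ (invPolys n) := by
  have : FiniteDimensional ℚ (MvPolynomial.homogeneousSubmodule (Fin 2) ℚ n) :=
    Module.Finite.of_fg (MvPolynomial.homogeneousSubmodule_fg _ _ n)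
  exact Submodule.finiteDimensional_of_le (inf_le_left : invPolys n ≤ _)

/-- The recursive description of the antisymmetric invariants. -/
noncomputable def invPolysStep (k : ℕ) :
    (ℚ × invPolys (2 * k)) →ₗ[ℚ] invPolys (6 + 2 * k) :=
  (LinearMap.toSpanSingleton ℚ _ ⟨altInv * quadInv ^ k, altInv_mul_mem_invPolys k⟩).coprod
    ((LinearMap.mulLeft ℚ sqInv).restrict fun _ hR => mul_sqInv_mem_invPolys_iff.2 hR)

lemma invPolysStep_apply (k : ℕ) (x : ℚ × invPolys (2 * k)) :
    (invPolysStep k x).1 = x.1 • (altInv * quadInv ^ k) + sqInv * x.2.1 := rfl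

/-- `linCoeff` is 2 on `altInv * quadInv ^ k` and 0 on multiples of `sqInv`, and invariants killed
by it are such multiples. Hence the line through the former complements the latter. -/
lemma bijective_invPolysStep (k : ℕ) : Function.Bijective (invPolysStep k) := by
  constructor
  · refine (injective_iff_map_eq_zero _).2 fun x hx => ?_
    have h : (invPolysStep k x).1 = 0 := congrArg Subtype.val hx
    rw [invPolysStep_apply] at h
    have h1 := congrArg linCoeff h
    rw [map_add, map_smul, linCoeff_altInv_mul, linCoeff_sqInv_mul, map_zero, smul_eq_mul] at h1
    have hx1 : x.1 = 0 := by linarith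
    rw [hx1, zero_smul, zero_add] at h
    exact Prod.ext hx1 (Subtype.ext ((mul_eq_zero.1 h).resolve_left sqInv_ne_zero))
  · rintro ⟨Q, hQ⟩
    have hQ' : Q - (linCoeff Q / 2) • (altInv * quadInv ^ k) ∈ invPolys (6 + 2 * k) :=
      Submodule.sub_mem _ hQ (Submodule.smul_mem _ _ (altInv_mul_mem_invPolys k))
    obtain ⟨R, hR⟩ := sqInv_dvd_of_linCoeff hQ' (by
      rw [map_sub, map_smul, linCoeff_altInv_mul, smul_eq_mul]
      ring)
    refine ⟨⟨linCoeff Q / 2, ⟨R, mul_sqInv_mem_invPolys_iff.1 (hR ▸ hQ')⟩⟩, Subtype.ext ?_⟩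
    rw [invPolysStep_apply]
    simp only
    rw [← hR]
    ring

/-- In degree 4 antisymmetry and vanishing on the axes leave Q = c(x³y - xy³). Rotation and swap
give Q(2, 1) = Q(1, 2) = -Q(2, 1), so 6c = 0. -/
lemma linCoeff_eq_zero_of_lt {k : ℕ} (hk : k < 3) {Q : MvPolynomial (Fin 2) ℚ}
    (hQ : Q ∈ invPolys (2 * k)) : linCoeff Q = 0 := by
  obtain ⟨hhom, hsw, hrot⟩ := mem_invPolys.1 hQ
  interval_cases k
  · refine map_eq_zero_of_isHomogeneous linCoeff (fun a b hab => ?_) hhom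
    obtain ⟨rfl, rfl⟩ : a = 0 ∧ b = 0 := by omega
    rw [linCoeff_apply]
    simp [Polynomial.coeff_one]
  · rw [linCoeff_eq_coeff (n := 1) hhom]
    exact self_eq_neg.1 (coeff_swap_of_swapVars hsw 1 1)
  · rw [linCoeff_eq_coeff (n := 3) hhom]
    have h1 := coeff_swap_of_swapVars hsw 3 1
    have h2 := self_eq_neg.1 (coeff_swap_of_swapVars hsw 2 2)
    have h3 := coeff_swap_of_swapVars hsw 4 0
    have h0 : MvPolynomial.coeff (exp2 4 0) Q = 0 := by
      rw [← coeff_aeval_X_zero Q (exp2_one 4 0), aeval_X_zero_eq_zero hsw hrot,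
        MvPolynomial.coeff_zero]
    have hev : MvPolynomial.aeval ![(2 : ℚ), 1] Q = 0 := by
      have e1 : MvPolynomial.aeval ![(2 : ℚ), 1] (rotVars Q) =
          MvPolynomial.aeval ![(1 : ℚ), 2] Q := by
        rw [aeval_rotVars]
        norm_num
      have e2 : MvPolynomial.aeval ![(2 : ℚ), 1] (swapVars Q) =
          MvPolynomial.aeval ![(1 : ℚ), 2] Q := aeval_swapVars _ _ _
      rw [hrot] at e1
      rw [hsw, map_neg] at e2
      linarith
    have key : MvPolynomial.aeval ![(2 : ℚ), 1] Q =
        ∑ a ∈ Finset.range 5, MvPolynomial.coeff (exp2 a (4 - a)) Q * 2 ^ a := by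
      rw [← sub_eq_zero]
      have := map_eq_zero_of_isHomogeneous ((MvPolynomial.aeval ![(2 : ℚ), 1]).toLinearMap -
        ∑ a ∈ Finset.range 5, (2 : ℚ) ^ a • MvPolynomial.lcoeff ℚ (exp2 a (4 - a)))
        (fun a b hab => ?_) hhom
      · simpa [LinearMap.sum_apply, mul_comm] using this
      · have ha : a < 5 := by omega
        obtain rfl : b = 4 - a := by omega
        simp only [LinearMap.sub_apply, LinearMap.sum_apply, LinearMap.smul_apply,
          MvPolynomial.lcoeff_apply, coeff_X_pow_mul_X_pow, AlgHom.toLinearMap_apply]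
        interval_cases a <;> simp [Finset.sum_range_succ]
    rw [hev] at key
    simp only [Finset.sum_range_succ, Finset.sum_range_zero, Nat.reduceSub] at key
    rw [h0, h1, h2, h3, h0] at key
    linarith

/-- A multiple of `sqInv` of degree below 6 is zero. -/
lemma invPolys_eq_bot {k : ℕ} (hk : k < 3) : invPolys (2 * k) = ⊥ := by
  rw [Submodule.eq_bot_iff]
  intro Q hQ
  obtain ⟨R, rfl⟩ := sqInv_dvd_of_linCoeff hQ (linCoeff_eq_zero_of_lt hk hQ)
  by_contra hne
  have h1 := (mem_invPolys.1 hQ).1.totalDegree hne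
  rw [MvPolynomial.totalDegree_mul_of_isDomain sqInv_ne_zero (right_ne_zero_of_mul hne),
    isHomogeneous_sqInv.totalDegree sqInv_ne_zero] at h1
  omega

lemma finrank_invPolys (k : ℕ) : Module.finrank ℚ (invPolys (2 * k)) = k / 3 := by
  induction k using Nat.strong_induction_on with
  | _ k ih =>
    by_cases hk : k < 3
    · rw [invPolys_eq_bot hk, finrank_bot]
      omega
    · obtain ⟨l, rfl⟩ := Nat.exists_eq_add_of_le (not_lt.1 hk)
      have h := (LinearEquiv.ofBijective _ (bijective_invPolysStep l)).finrank_eq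
      rw [Module.finrank_prod, Module.finrank_self, ih l (by omega)] at h
      rw [show 2 * (3 + l) = 6 + 2 * l by ring, ← h]
      omega

/-! ### The dimension of W_{N,2} and the series 𝕊 and 𝕆. -/

/-- Coordinates on the antisymmetric polynomials. -/
noncomputable def antisymmCoords (N : ℕ) : antisymmPolys N →ₗ[ℚ] (Fin (N / 4 - 1) → ℚ) :=
  LinearMap.pi fun i => MvPolynomial.lcoeff ℚ (exp2 (2 * i + 2) (N - 4 - 2 * i)) ∘ₗ
    (evenPolys N 2).subtype ∘ₗ (antisymmPolys N).subtype

lemma antisymmCoords_apply {N : ℕ} (P : antisymmPolys N) (i : Fin (N / 4 - 1)) :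
    antisymmCoords N P i = MvPolynomial.coeff (exp2 (2 * i + 2) (N - 4 - 2 * i)) P.1.1 := rfl

/-- For even N the pairs (2i + 2, N - 4 - 2i) with i < N/4 - 1 are exactly the admissible exponents
(a, b) with a < b; antisymmetry determines the other coefficients. -/
lemma injective_antisymmCoords (N : ℕ) : Function.Injective (antisymmCoords N) := by
  refine (injective_iff_map_eq_zero _).2 fun P hP => ?_
  have hsw := mem_antisymmPolys.1 P.2
  have hlt : ∀ a b, a < b → MvPolynomial.coeff (exp2 a b) P.1.1 = 0 := by
    intro a b hab
    by_cases hev : ∀ i, Even (exp2 a b i) ∧ 2 ≤ exp2 a b i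
    · by_cases hN : a + b = N - 2
      · obtain ⟨⟨c, hc⟩, ha2⟩ := (Fin.forall_fin_two.1 hev).1
        rw [exp2_zero] at hc ha2
        obtain ⟨⟨e, he⟩, hb2⟩ := (Fin.forall_fin_two.1 hev).2
        rw [exp2_one] at he hb2
        have h := congrFun hP ⟨c - 1, by omega⟩
        rw [antisymmCoords_apply] at h
        simp only at h
        rwa [show 2 * (c - 1) + 2 = a by omega, show N - 4 - 2 * (c - 1) = b by omega] at h
      · refine (isHomogeneous_of_mem_evenPolys P.1).coeff_eq_zero ?_
        rwa [Finsupp.degree_eq_sum, Fin.sum_univ_two, exp2_zero, exp2_one]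
    · exact coeff_eq_zero_of_mem_evenPolys P.1 hev
  apply Subtype.ext
  apply Subtype.ext
  ext d
  rw [← exp2_self d]
  change _ = MvPolynomial.coeff (exp2 (d 0) (d 1)) (0 : MvPolynomial (Fin 2) ℚ)
  rw [MvPolynomial.coeff_zero]
  rcases lt_trichotomy (d 0) (d 1) with h | h | h
  · exact hlt _ _ h
  · rw [h]
    exact self_eq_neg.1 (coeff_swap_of_swapVars hsw _ _)
  · rw [coeff_swap_of_swapVars hsw, hlt _ _ h, neg_zero]

lemma surjective_antisymmCoords {N : ℕ} (hN : Even N) :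
    Function.Surjective (antisymmCoords N) := by
  intro v
  obtain ⟨M, hM⟩ := hN
  have hmem : ∀ i : Fin (N / 4 - 1),
      ((MvPolynomial.X 0 : MvPolynomial (Fin 2) ℚ) ^ (2 * i.val + 2) *
        MvPolynomial.X 1 ^ (N - 4 - 2 * i.val) - MvPolynomial.X 0 ^ (N - 4 - 2 * i.val) *
        MvPolynomial.X 1 ^ (2 * i.val + 2)) ∈ evenPolys N 2 := by
    intro i
    have hi := i.2
    have e1 : Even (2 * i.val + 2) := ⟨i.val + 1, by ring⟩
    have e2 : Even (N - 4 - 2 * i.val) := ⟨M - 2 - i.val, by omega⟩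
    exact Submodule.sub_mem _
      (X_pow_mul_X_pow_mem_evenPolys e1 (by omega) e2 (by omega) (by omega))
      (X_pow_mul_X_pow_mem_evenPolys e2 (by omega) e1 (by omega) (by omega))
  have hmem2 : ∀ i : Fin (N / 4 - 1),
      (⟨_, hmem i⟩ : evenPolys N 2) ∈ antisymmPolys N := by
    intro i
    rw [mem_antisymmPolys]
    simp [swapVars, mul_comm]
  refine ⟨∑ i, v i • ⟨⟨_, hmem i⟩, hmem2 i⟩, ?_⟩
  funext j
  rw [map_sum, Finset.sum_apply, Finset.sum_eq_single j]
  · rw [map_smul, Pi.smul_apply, antisymmCoords_apply]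
    simp only
    have hj := j.2
    rw [MvPolynomial.coeff_sub, coeff_X_pow_mul_X_pow, coeff_X_pow_mul_X_pow, if_pos ⟨rfl, rfl⟩,
      if_neg (by omega)]
    simp
  · intro i _ hij
    have hi := i.2
    have hj := j.2
    have hne : i.val ≠ j.val := fun h => hij (Fin.ext h)
    rw [map_smul, Pi.smul_apply, antisymmCoords_apply]
    simp only
    rw [MvPolynomial.coeff_sub, coeff_X_pow_mul_X_pow, coeff_X_pow_mul_X_pow,
      if_neg (by omega), if_neg (by omega)]
    simp
  · simp

lemma finrank_antisymmPolys {N : ℕ} (hN : Even N) :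
    Module.finrank ℚ (antisymmPolys N) = N / 4 - 1 := by
  rw [(LinearEquiv.ofBijective _
    ⟨injective_antisymmCoords N, surjective_antisymmCoords hN⟩).finrank_eq]
  simp

lemma mem_periodPolys_two_iff {N : ℕ} {P : evenPolys N 2} :
    P ∈ periodPolys N 2 ↔ P ∈ antisymmPolys N ∧ rotSum P.1 = 0 := by
  constructor
  · intro h
    have hsw : swapVars P.1 = -P.1 := by
      have h1 := periodPolys_antisymm (l := 0) h
        (MvPolynomial.X : Fin 2 → MvPolynomial (Fin 2) ℚ)
      rw [MvPolynomial.aeval_X_left_apply] at h1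
      rw [← h1, swapVars]
      congr 2
      funext i
      fin_cases i <;> simp
    refine ⟨mem_antisymmPolys.2 hsw, ?_⟩
    rw [rotSum_apply, ← periodDefect_two_eq P hsw]
    exact mem_periodPolys_iff_periodDefect.1 h
  · rintro ⟨h1, h2⟩
    rw [mem_periodPolys_iff_periodDefect, periodDefect_two_eq P (mem_antisymmPolys.1 h1)]
    exact h2

/-- Rank-nullity for 1 + U + U² from the antisymmetric polynomials in V_{N,2} onto the antisymmetric
invariants of degree N - 2. -/
lemma finrank_periodPolys_two_add {N : ℕ} (hN : Even N) (hN4 : 4 ≤ N) :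
    Module.finrank ℚ (periodPolys N 2) + (N - 2) / 6 = N / 4 - 1 := by
  have hn : Even (N - 2) := (Nat.even_sub (by omega)).2 (by simp [hN])
  let L : antisymmPolys N →ₗ[ℚ] invPolys (N - 2) :=
    (rotSum ∘ₗ (evenPolys N 2).subtype ∘ₗ (antisymmPolys N).subtype).codRestrict _ fun P =>
      rotSum_mem_invPolys hn (isHomogeneous_of_mem_evenPolys P.1) (mem_antisymmPolys.1 P.2)
  have hsurj : LinearMap.range L = ⊤ := by
    rw [LinearMap.range_eq_top]
    rintro ⟨Q, hQ⟩
    obtain ⟨P, hP, h⟩ := exists_rotSum_eq hN hN4 hQ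
    exact ⟨⟨P, hP⟩, Subtype.ext h⟩
  have hker : (LinearMap.ker L).map (antisymmPolys N).subtype = periodPolys N 2 := by
    ext P
    rw [mem_periodPolys_two_iff]
    constructor
    · rintro ⟨P, hP, rfl⟩
      exact ⟨P.2, congrArg Subtype.val hP⟩
    · rintro ⟨h1, h2⟩
      exact ⟨⟨P, h1⟩, Subtype.ext h2, rfl⟩
  have h := LinearMap.finrank_range_add_finrank_ker (V := antisymmPolys N)
    (V₂ := invPolys (N - 2)) L
  rw [hsurj, finrank_top, finrank_antisymmPolys hN] at h
  rw [← hker, (Submodule.equivMapOfInjective _ (Submodule.subtype_injective _) _).symm.finrank_eq,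
    ← h, add_comm]
  congr 1
  obtain ⟨k, hk⟩ := hn
  rw [show N - 2 = 2 * k by omega, finrank_invPolys]
  omega

lemma finrank_periodPolys_two_eq_zero {N : ℕ} (hN : ¬(Even N ∧ 4 ≤ N)) :
    Module.finrank ℚ (periodPolys N 2) = 0 := by
  have hempty : IsEmpty (OddIdx N 2) := by
    refine ⟨fun m => hN ?_⟩
    obtain ⟨h1, h2⟩ := mem_oddIndices.1 m.2
    rw [Fin.sum_univ_two] at h1
    exact ⟨h1 ▸ (h2 0).2.add_odd (h2 1).2, by have := (h2 0).1; have := (h2 1).1; omega⟩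
  have h := Submodule.finrank_le (periodPolys N 2)
  rw [(coeffEquiv N 2).finrank_eq, Module.finrank_fintype_fun_eq_card, Fintype.card_eq_zero] at h
  omega

lemma seriesS_eq : seriesS = PowerSeries.mk fun N => (Module.finrank ℚ (periodPolys N 2) : ℚ) := by
  have h0 : PowerSeries.constantCoeff
      (((1 : PowerSeries ℚ) - PowerSeries.X ^ 4) * (1 - PowerSeries.X ^ 6)) ≠ 0 := by simp
  rw [seriesS, eq_comm, PowerSeries.eq_mul_inv_iff_mul_eq h0]
  have hexp : ∀ A : PowerSeries ℚ, A * ((1 - PowerSeries.X ^ 4) * (1 - PowerSeries.X ^ 6)) =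
      A - A * PowerSeries.X ^ 4 - A * PowerSeries.X ^ 6 + A * PowerSeries.X ^ 10 := by
    intro A
    ring
  rw [hexp]
  ext N
  simp only [map_add, map_sub, PowerSeries.coeff_mul_X_pow', PowerSeries.coeff_mk,
    PowerSeries.coeff_X_pow]
  have hw : ∀ M, (M % 2 = 0 ∧ 4 ≤ M ∧
      Module.finrank ℚ (periodPolys M 2) + (M - 2) / 6 = M / 4 - 1) ∨
      (¬(M % 2 = 0 ∧ 4 ≤ M) ∧ Module.finrank ℚ (periodPolys M 2) = 0) := by
    intro M
    rw [← Nat.even_iff]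
    by_cases hM : Even M ∧ 4 ≤ M
    · exact Or.inl ⟨hM.1, hM.2, finrank_periodPolys_two_add hM.1 hM.2⟩
    · exact Or.inr ⟨hM, finrank_periodPolys_two_eq_zero hM⟩
  -- After clearing denominators, the claim is a linear recurrence for the dimensions with the
  -- single source term x^12, to be checked from their floor formulas.
  have hint : (Module.finrank ℚ (periodPolys N 2) : ℤ) -
      (if 4 ≤ N then (Module.finrank ℚ (periodPolys (N - 4) 2) : ℤ) else 0) -
      (if 6 ≤ N then (Module.finrank ℚ (periodPolys (N - 6) 2) : ℤ) else 0) +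
      (if 10 ≤ N then (Module.finrank ℚ (periodPolys (N - 10) 2) : ℤ) else 0) =
      if N = 12 then 1 else 0 := by
    have e0 := hw N
    have e4 := hw (N - 4)
    have e6 := hw (N - 6)
    have e10 := hw (N - 10)
    generalize Module.finrank ℚ (periodPolys N 2) = w0 at *
    generalize Module.finrank ℚ (periodPolys (N - 4) 2) = w4 at *
    generalize Module.finrank ℚ (periodPolys (N - 6) 2) = w6 at *
    generalize Module.finrank ℚ (periodPolys (N - 10) 2) = w10 at *
    clear hw hexp h0
    rcases Nat.even_or_odd' N with ⟨M, rfl | rfl⟩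
    · split_ifs <;> omega
    · split_ifs <;> omega
  exact_mod_cast congrArg (Int.cast : ℤ → ℚ) hint

lemma card_oddIdx_one (N : ℕ) :
    Fintype.card (OddIdx N 1) = if N % 2 = 1 ∧ 3 ≤ N then 1 else 0 := by
  split_ifs with h
  · rw [Fintype.card_eq_one_iff]
    refine ⟨⟨fun _ => N, mem_oddIndices.2 ⟨by simp, fun _ => ⟨h.2, Nat.odd_iff.2 h.1⟩⟩⟩, ?_⟩
    intro m
    have hm := (mem_oddIndices.1 m.2).1
    apply Subtype.ext
    funext i
    rw [Fin.sum_univ_one] at hm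
    rw [Subsingleton.elim i 0]
    exact hm
  · rw [Fintype.card_eq_zero_iff]
    refine ⟨fun m => h ?_⟩
    obtain ⟨h1, h2⟩ := mem_oddIndices.1 m.2
    rw [Fin.sum_univ_one] at h1
    rw [← h1]
    exact ⟨Nat.odd_iff.1 (h2 0).2, (h2 0).1⟩

lemma seriesO_eq : seriesO = PowerSeries.mk fun N => (Fintype.card (OddIdx N 1) : ℚ) := by
  have h0 : PowerSeries.constantCoeff ((1 : PowerSeries ℚ) - PowerSeries.X ^ 2) ≠ 0 := by simp
  rw [seriesO, eq_comm, PowerSeries.eq_mul_inv_iff_mul_eq h0, mul_sub, mul_one]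
  ext N
  simp only [map_sub, PowerSeries.coeff_mul_X_pow', PowerSeries.coeff_mk,
    PowerSeries.coeff_X_pow, card_oddIdx_one]
  have hint : ((if N % 2 = 1 ∧ 3 ≤ N then 1 else 0 : ℕ) : ℤ) -
      (if 2 ≤ N then ((if (N - 2) % 2 = 1 ∧ 3 ≤ N - 2 then 1 else 0 : ℕ) : ℤ) else 0) =
      if N = 3 then 1 else 0 := by
    split_ifs <;> omega
  exact_mod_cast congrArg (Int.cast : ℤ → ℚ) hint

/-! ### The recursion for the ranks and the generating series. -/

/-- The coefficients of the rank series. -/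
noncomputable def rankCoeff (N r : ℕ) : ℕ :=
  if r = 0 then (if N = 0 then 1 else 0) else (matC N r).rank

lemma oddIdx_isEmpty_zero (r : ℕ) : IsEmpty (OddIdx 0 (r + 1)) := by
  refine ⟨fun m => ?_⟩
  obtain ⟨h1, h2⟩ := mem_oddIndices.1 m.2
  rw [Finset.sum_eq_zero_iff] at h1
  have h3 := (h2 0).1
  rw [h1 0 (Finset.mem_univ _)] at h3
  omega

lemma coeff_rankSeries (N r : ℕ) :
    PowerSeries.coeff N (PowerSeries.coeff r rankSeries) = (rankCoeff N r : ℚ) := by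
  rw [rankSeries, map_add, map_add, PowerSeries.coeff_mk, PowerSeries.coeff_mk,
    PowerSeries.coeff_one, rankCoeff]
  rcases Nat.eq_zero_or_pos r with rfl | hr
  · simp [PowerSeries.coeff_one]
  · rw [if_neg hr.ne', if_neg hr.ne', map_zero, zero_add]
    rcases Nat.eq_zero_or_pos N with rfl | hN
    -- The series omits weight 0 in positive depth; there the matrix is empty and has rank 0 anyway.
    · obtain ⟨s, rfl⟩ := Nat.exists_eq_add_of_le' hr
      have := oddIdx_isEmpty_zero s
      have h := Matrix.rank_le_card_width (matC 0 (s + 1))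
      rw [Fintype.card_eq_zero] at h
      rw [if_neg (by simp), Nat.le_zero.1 h, Nat.cast_zero]
    · rw [if_pos ⟨hN, hr⟩]

lemma rankCoeff_one (N : ℕ) : rankCoeff N 1 = Fintype.card (OddIdx N 1) := by
  rw [rankCoeff, if_neg one_ne_zero, ← matEprod_self le_rfl]
  simp [matEprod]

lemma finrank_map_phiComp_periodPolys_eq (h_inj : TasakaInjectivity) {N : ℕ} (hN : 0 < N)
    (l : ℕ) : Module.finrank ℚ ((periodPolys N (l + 2)).map (phiComp N (l + 2) (l + 1))) =
      ∑ n : Fin (N + 1), Module.finrank ℚ (periodPolys n 2) * rankCoeff (N - n) l := by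
  rcases l with _ | l
  -- In depth two `rankCoeff (N - n) 0` is nonzero only for n = N, so the sum reduces to dim
  -- W_{N,2}.
  · rw [show phiComp N (0 + 2) (0 + 1) = LinearMap.id from rfl, Submodule.map_id,
      Finset.sum_eq_single (Fin.last N)]
    · simp [rankCoeff]
    · intro n _ hn
      have : n.val ≠ N := fun h => hn (Fin.ext h)
      have := n.2
      rw [rankCoeff, if_pos rfl, if_neg (by omega), mul_zero]
    · simp
  · rw [show l + 1 + 2 = l + 3 from rfl, finrank_map_phiComp_succ_periodPolys h_inj hN]
    have h := finrank_map_phiComp_periodPolys (N := N) (l := l + 1) (by omega)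
    rw [show 2 + (l + 1) = l + 3 by omega] at h
    exact h

/-- For r ≥ 3 this is the second assumption; for r = 2 it is `ker_phi_two`. -/
lemma ker_phi_inf_range_phiComp (h_im : ImageKernelConjecture) {N : ℕ} (hN : 0 < N) (l : ℕ) :
    LinearMap.ker (phi N (l + 2) (l + 2)) ⊓ LinearMap.range (phiComp N (l + 2) (l + 1)) =
      (periodPolys N (l + 2)).map (phiComp N (l + 2) (l + 1)) := by
  rcases l with _ | l
  · rw [show phiComp N (0 + 2) (0 + 1) = LinearMap.id from rfl, Submodule.map_id,
      LinearMap.range_id, inf_top_eq]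
    exact ker_phi_two N
  · exact (h_im (l + 3) N (by omega) hN).symm

/-- Rank-nullity for φ_{l+2} on the image of the previous maps, with all three dimensions written in
ranks. It is stated additively to avoid truncated subtraction. -/
lemma rankCoeff_add (h_inj : TasakaInjectivity) (h_im : ImageKernelConjecture) (N l : ℕ) :
    rankCoeff N (l + 2) +
      ∑ n : Fin (N + 1), Module.finrank ℚ (periodPolys n 2) * rankCoeff (N - n) l =
      ∑ n : Fin (N + 1), Fintype.card (OddIdx n 1) * rankCoeff (N - n) (l + 1) := by
  rcases Nat.eq_zero_or_pos N with rfl | hN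
  -- The assumptions only cover N > 0; in weight 0 every term vanishes.
  · have := oddIdx_isEmpty_zero (l + 1)
    have h := Matrix.rank_le_card_width (matC 0 (l + 2))
    rw [Fintype.card_eq_zero] at h
    have h2 : Module.finrank ℚ (periodPolys 0 2) = 0 :=
      finrank_periodPolys_two_eq_zero (by omega)
    have h3 : Fintype.card (OddIdx 0 1) = 0 := by
      rw [card_oddIdx_one, if_neg (by omega)]
    have h4 : ∀ n : Fin (0 + 1), n.val = 0 := fun n => by omega
    rw [Finset.sum_eq_zero fun n _ => by rw [h4, h2, zero_mul],
      Finset.sum_eq_zero fun n _ => by rw [h4, h3, zero_mul],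
      rankCoeff, if_neg (by omega), Nat.le_zero.1 h, add_zero]
  · have h := finrank_range_comp_add_finrank_inf (phi N (l + 2) (l + 2))
      (phiComp N (l + 2) (l + 1))
    rw [ker_phi_inf_range_phiComp h_im hN, finrank_map_phiComp_periodPolys_eq h_inj hN] at h
    have h3 := finrank_range_phiComp (N := N) (l := l + 1) (by omega)
    rw [show 1 + (l + 1) = l + 2 by omega] at h3
    rw [h3] at h
    rw [rankCoeff, if_neg (by omega), rank_matC_eq (by omega)]
    exact h

lemma coeff_mk_mul_coeff_rankSeries (w : ℕ → ℕ) (N r : ℕ) :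
    PowerSeries.coeff N (PowerSeries.mk (fun n => (w n : ℚ)) * PowerSeries.coeff r rankSeries) =
      ((∑ n : Fin (N + 1), w n * rankCoeff (N - n) r : ℕ) : ℚ) := by
  rw [PowerSeries.coeff_mul, Finset.Nat.sum_antidiagonal_eq_sum_range_succ_mk,
    Fin.sum_univ_eq_sum_range (fun n => w n * rankCoeff (N - n) r)]
  push_cast
  exact Finset.sum_congr rfl fun n _ => by rw [PowerSeries.coeff_mk, coeff_rankSeries]

theorem mainTheorem5 (h_inj : TasakaInjectivity) (h_im : ImageKernelConjecture) :
    rankSeries =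
      PowerSeries.invOfUnit
        (1 - PowerSeries.C seriesO * PowerSeries.X + PowerSeries.C seriesS * PowerSeries.X ^ 2)
        1 := by
  set D : PowerSeries (PowerSeries ℚ) :=
    1 - PowerSeries.C seriesO * PowerSeries.X + PowerSeries.C seriesS * PowerSeries.X ^ 2 with hD
  have hzero : PowerSeries.coeff 0 rankSeries = 1 := by
    ext N
    rw [coeff_rankSeries, rankCoeff, if_pos rfl, PowerSeries.coeff_one]
    simp
  have hone : PowerSeries.coeff 1 rankSeries = seriesO := by
    ext N
    rw [coeff_rankSeries, rankCoeff_one, seriesO_eq, PowerSeries.coeff_mk]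
  have hrec : ∀ r, PowerSeries.coeff (r + 2) rankSeries -
      seriesO * PowerSeries.coeff (r + 1) rankSeries +
      seriesS * PowerSeries.coeff r rankSeries = 0 := by
    intro r
    ext N
    rw [seriesO_eq, seriesS_eq, map_add, map_sub, coeff_mk_mul_coeff_rankSeries,
      coeff_mk_mul_coeff_rankSeries, coeff_rankSeries, ← rankCoeff_add h_inj h_im, map_zero]
    push_cast
    ring
  -- The recursion kills the coefficients of y^r for r ≥ 2; those for r = 0 and r = 1 are `hzero`
  -- and `hone`.
  have hmul : rankSeries * D = 1 := by
    have hexp : rankSeries * D = rankSeries - PowerSeries.C seriesO * (rankSeries * PowerSeries.X) +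
        PowerSeries.C seriesS * (rankSeries * PowerSeries.X ^ 2) := by
      rw [hD]
      ring
    rw [hexp]
    ext1 r
    rw [map_add, map_sub, PowerSeries.coeff_C_mul, PowerSeries.coeff_C_mul,
      PowerSeries.coeff_mul_X_pow', PowerSeries.coeff_one]
    rcases r with _ | _ | r
    · simp [hzero]
    · rw [PowerSeries.coeff_succ_mul_X, hone]
      simp [hzero]
    · rw [PowerSeries.coeff_succ_mul_X, if_pos (by omega), if_neg (by omega)]
      exact hrec r
  -- `invOfUnit` is a true inverse here since D has constant coefficient 1 in y.
  have hinv : D * PowerSeries.invOfUnit D 1 = 1 := by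
    refine PowerSeries.mul_invOfUnit D 1 ?_
    simp [hD]
  calc rankSeries = rankSeries * (D * PowerSeries.invOfUnit D 1) := by rw [hinv, mul_one]
    _ = PowerSeries.invOfUnit D 1 := by rw [← mul_assoc, hmul, one_mul]
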